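/- Let $H_{\mathbb R}$ be a finite-dimensional real Hilbert space with complexification $H=H_{\mathbb R}\otimes\mathbb C$, let $m=\dim H_{\mathbb R}$, and let $-1<q<1$. For $n\ge 0$ let $P_q^n$ be the operator on $H^{\otimes n}$ with $P_q^n(\xi_1\otimes\cdots\otimes\xi_n)=\sum_{\sigma\in S_n}q^{i(\sigma)}\,\xi_{\sigma(1)}\otimes\cdots\otimes\xi_{\sigma(n)}$, where $i(\sigma)$ is the number of inversions of $\sigma$. Let the $q$-Fock space $F_q(H)$ be the Hilbert space completion of $\bigoplus_{n\ge 0}H^{\otimes n}$ (with $H^{\otimes 0}=\mathbb C\Omega$, $\|\Omega\|=1$) for the inner product that equals $\langle\xi,\eta\rangle_q=\langle P_q^n\xi,\eta\rangle$ on $H^{\otimes n}$ and makes the different $H^{\otimes n}$ orthogonal. For $\xi\in H$ let $l_q(\xi)$ be the bounded operator on $F_q(H)$ with $l_q(\xi)\,\eta_1\otimes\cdots\otimes\eta_n=\xi\otimes\eta_1\otimes\cdots\otimes\eta_n$. Let $\mathcal A_q\subseteq B(F_q(H))$ be the unital $*$-algebra generated by the operators $s_q(\xi)=l_q(\xi)+l_q(\xi)^*$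 with $\xi\in H_{\mathbb R}$. 1. For every orthonormal basis $e_1,\dots,e_m$ of $H_{\mathbb R}$ there is an isomorphism of $*$-algebras from the free algebra $\mathbb C\langle X_1,\dots,X_m\rangle$ of noncommutative polynomials in $m$ self-adjoint variables $X_i=X_i^*$ onto $\mathcal A_q$ that maps $X_i$ to $s_q(e_i)$ for all $i$. 2. Let $V$ be an $\mathcal A_q$-$\mathcal A_q$-bimodule, that is, a complex vector space with commuting linear left and right actions of $\mathcal A_q$ (the unit need not act as the identity; for example, a Hilbert space with commuting $*$-homomorphisms $\mathcal A_q\to B(V)$ and $\mathcal A_q^{\mathrm{op}}\to B(V)$). For $n\ge 0$ let $F_n$ be the space of all linear maps $\mathcal A_q^{\otimes n}\to V$ (so $F_0=V$), and let $d_n\colon F_n\to F_{n+1}$ be given by $$(d_nf)(a_1\otimes\cdots\otimes a_{n+1})=a_1 f(a_2\otimes\cdots\otimes a_{n+1})+\sum_{k=1}^{n}(-1)^k f(a_1\otimes\cdots\otimes a_ka_{k+1}\otimes\cdots\otimes a_{n+1})+(-1)^{n+1}f(a_1\otimes\cdots\otimes a_n)\,a_{n+1}.$$ Then the Hochschild cohomology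 group $H^n(\mathcal A_q,V)=\ker d_n/\operatorname{im}d_{n-1}$ is $0$ for every $n\ge 2$. -/

import Mathlib

open scoped TensorProduct ComplexConjugate

/- Hochschild cohomology of an associative algebra through the bar resolution. -/
namespace Hochschild

variable {k A V : Type*} [CommRing k] [Ring A] [Algebra k A] [AddCommGroup V] [Module k V]

/-- An `A`-`A`-bimodule: a `k`-module `V` with an action of `A` from the left and an action of `A`
from the right (an action of the opposite algebra) that commute. The unit of `A` is not required to
act as the identity. In particular, a Hilbert space with commuting `*`-homomorphisms
`A → B(V)` and `Aᵒᵖ → B(V)` (unital or not) is such a bimodule. -/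
structure Bimodule (k A V : Type*) [CommRing k] [Ring A] [Algebra k A] [AddCommGroup V]
    [Module k V] where
  left : A →ₙₐ[k] Module.End k V
  right : Aᵐᵒᵖ →ₙₐ[k] Module.End k V
  comm : ∀ (a b : A) (v : V),
    left a (right (MulOpposite.op b) v) = right (MulOpposite.op b) (left a v)

/-- Multiplying two neighbouring entries of a tuple one entry of which is updated. -/
theorem contractNth_update {n : ℕ} (j : Fin n) (a : Fin (n + 1) → A) (i : Fin (n + 1)) (x : A) :
    Fin.contractNth j.castSucc (· * ·) (Function.update a i x) =
      Function.update (Fin.contractNth j.castSucc (· * ·) a) (j.predAbove i)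
        (if i = j.castSucc then x * a j.succ else if i = j.succ then a j.castSucc * x else x) := by
  funext l
  rcases Nat.lt_trichotomy i j with h | h | h
  · have h1 : j.predAbove i = i.castLT (by omega) := by
      rw [Fin.predAbove_of_le_castSucc _ _ (by rw [Fin.le_def]; simp; omega)]; rfl
    rw [h1]
    simp only [Fin.contractNth, Function.update_apply, Fin.ext_iff, Fin.val_castSucc, Fin.val_succ,
      Fin.val_castLT]
    split_ifs <;> first | rfl | omega
  · have h1 : j.predAbove i = j := by
      rw [Fin.predAbove_of_le_castSucc _ _ (by rw [Fin.le_def]; simp; omega)]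
      ext; simpa using h
    rw [h1]
    simp only [Fin.contractNth, Function.update_apply, Fin.ext_iff, Fin.val_castSucc, Fin.val_succ]
    have hs : l = j → l.succ = j.succ := fun h => by rw [h]
    split_ifs <;> first | rfl | omega | (rw [hs (Fin.ext (by omega))])
  · have h1 : j.predAbove i = i.pred (by rintro rfl; simp at h) := by
      rw [Fin.predAbove_of_castSucc_lt _ _ (by rw [Fin.lt_def]; simpa using h)]
    rw [h1]
    simp only [Fin.contractNth, Function.update_apply, Fin.ext_iff, Fin.val_castSucc, Fin.val_succ,
      Fin.val_pred]
    have hs : l = j → l.castSucc = j.castSucc := fun h => by rw [h]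
    split_ifs <;> first | rfl | omega | (rw [hs (Fin.ext (by omega))])

/-- The multilinear map `(a₀, …, aₙ) ↦ f (a₀, …, aⱼ aⱼ₊₁, …, aₙ)`. -/
def contract {n : ℕ} (j : Fin n) (f : MultilinearMap k (fun _ : Fin n => A) V) :
    MultilinearMap k (fun _ : Fin (n + 1) => A) V :=
  MultilinearMap.mk' (fun a => f (Fin.contractNth j.castSucc (· * ·) a))
    (fun a i x y => by
      simp only [contractNth_update]
      rw [← f.map_update_add]
      congr 2
      split_ifs <;> simp [add_mul, mul_add])
    (fun a i c x => by
      simp only [contractNth_update]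
      rw [← f.map_update_smul]
      congr 2
      split_ifs <;> simp)

namespace Bimodule
variable (M : Bimodule k A V)

/-- `(a₀, …, aₙ) ↦ a₀ · f (a₁, …, aₙ)`. -/
def outerLeft {n : ℕ} (f : MultilinearMap k (fun _ : Fin n => A) V) :
    MultilinearMap k (fun _ : Fin (n + 1) => A) V :=
  MultilinearMap.mk' (fun a => M.left (a 0) (f (Fin.tail a)))
    (fun a i x y => by cases i using Fin.cases <;> simp [Ne.symm])
    (fun a i c x => by cases i using Fin.cases <;> simp [Ne.symm])

/-- `(a₀, …, aₙ) ↦ f (a₀, …, aₙ₋₁) · aₙ`. -/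
def outerRight {n : ℕ} (f : MultilinearMap k (fun _ : Fin n => A) V) :
    MultilinearMap k (fun _ : Fin (n + 1) => A) V :=
  MultilinearMap.mk'
    (fun a => M.right (MulOpposite.op (a (Fin.last n))) (f (Fin.init a)))
    (fun a i x y => by
      cases i using Fin.lastCases with
      | last => simp
      | cast i => simp [Function.update_of_ne (Fin.castSucc_lt_last i).ne'])
    (fun a i c x => by
      cases i using Fin.lastCases with
      | last => simp
      | cast i => simp [Function.update_of_ne (Fin.castSucc_lt_last i).ne'])

/-- The differential of the bar resolution, on the linear maps `A^{⊗ n} → V` (as multilinear maps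
in `n` variables):
`(d f)(a₁, …, aₙ₊₁) = a₁ f(a₂, …, aₙ₊₁) + ∑_{k=1}^{n} (-1)^k f(a₁, …, aₖ aₖ₊₁, …, aₙ₊₁)
  + (-1)^{n+1} f(a₁, …, aₙ) aₙ₊₁`.
For `n = 0` it is `ξ ↦ (a ↦ a ξ - ξ a)`. -/
def d (n : ℕ) :
    MultilinearMap k (fun _ : Fin n => A) V →ₗ[k] MultilinearMap k (fun _ : Fin (n + 1) => A) V where
  toFun f := M.outerLeft f + ∑ j : Fin n, (-1 : k) ^ ((j : ℕ) + 1) • contract j f +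
    (-1 : k) ^ (n + 1) • M.outerRight f
  map_add' f g := by
    ext a
    simp [outerLeft, outerRight, contract, Finset.sum_add_distrib]
    abel
  map_smul' c f := by
    ext a
    simp [outerLeft, outerRight, contract, Finset.smul_sum, smul_comm c]

/-- Hochschild `n`-cocycles. -/
def cocycles (n : ℕ) : Submodule k (MultilinearMap k (fun _ : Fin n => A) V) :=
  LinearMap.ker (M.d n)

/-- Hochschild `n`-coboundaries. -/
def coboundaries : (n : ℕ) → Submodule k (MultilinearMap k (fun _ : Fin n => A) V)
  | 0 => ⊥
  | n + 1 => LinearMap.range (M.d n)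

/-- The `n`-th Hochschild cohomology group: cocycles modulo coboundaries. -/
abbrev cohomology (n : ℕ) : Type _ :=
  M.cocycles n ⧸ (M.coboundaries n).submoduleOf (M.cocycles n)

end Bimodule
end Hochschild

/-- The free algebra `ℂ⟨X_i : i ∈ κ⟩` of noncommutative polynomials, to be given below the structure
of a `*`-algebra over `ℂ` (with conjugate-linear involution) in which the variables are
self-adjoint. -/
def NCPoly (κ : Type*) : Type _ := FreeAlgebra ℂ κ
namespace NCPoly
variable {κ : Type*}
noncomputable instance : Ring (NCPoly κ) := inferInstanceAs (Ring (FreeAlgebra ℂ κ))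
noncomputable instance : Algebra ℂ (NCPoly κ) := inferInstanceAs (Algebra ℂ (FreeAlgebra ℂ κ))

/-- The variable `X_i`. -/
noncomputable def X (i : κ) : NCPoly κ := FreeAlgebra.ι ℂ i

/-- Conjugation of the coefficients of a noncommutative polynomial. -/
noncomputable def conjCoeff : FreeAlgebra ℂ κ →+* FreeAlgebra ℂ κ :=
  (RingHomClass.toRingHom (FreeAlgebra.equivMonoidAlgebraFreeMonoid (R := ℂ) (X := κ)).symm).comp
    ((MonoidAlgebra.mapRingHom (FreeMonoid κ) (starRingEnd ℂ)).comp
      (RingHomClass.toRingHom (FreeAlgebra.equivMonoidAlgebraFreeMonoid (R := ℂ) (X := κ))))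

theorem conjCoeff_ι (i : κ) : conjCoeff (FreeAlgebra.ι ℂ i) = FreeAlgebra.ι ℂ i := by
  simp [conjCoeff, FreeAlgebra.equivMonoidAlgebraFreeMonoid]

theorem conjCoeff_algebraMap (c : ℂ) :
    conjCoeff (algebraMap ℂ (FreeAlgebra ℂ κ) c) = algebraMap ℂ _ (conj c) := by
  simp only [conjCoeff, RingHom.comp_apply, RingHom.coe_coe, AlgEquiv.commutes]
  rw [AlgEquiv.symm_apply_eq, AlgEquiv.commutes]
  simp

theorem aux_invol (p : FreeAlgebra ℂ κ) : star (conjCoeff (star (conjCoeff p))) = p := by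
  induction p with
  | grade0 r => simp [conjCoeff_algebraMap]
  | grade1 x => simp [conjCoeff_ι]
  | mul a b ha hb => simp only [map_mul, star_mul, ha, hb]
  | add a b ha hb => simp only [map_add, star_add, ha, hb]

/-- The involution: conjugate the coefficients and reverse the monomials (Mathlib's `star` on
`FreeAlgebra ℂ κ` only reverses the monomials). -/
noncomputable instance : StarRing (NCPoly κ) where
  star p := (star (conjCoeff p : FreeAlgebra ℂ κ) : FreeAlgebra ℂ κ)
  star_involutive p := aux_invol p
  star_mul a b := (congrArg star (map_mul (conjCoeff (κ := κ)) a b)).trans (star_mul _ _)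
  star_add a b := (congrArg star (map_add (conjCoeff (κ := κ)) a b)).trans (star_add _ _)

theorem star_X (i : κ) : star (X i) = X i :=
  (congrArg star (conjCoeff_ι i)).trans (FreeAlgebra.star_ι i)

instance : StarModule ℂ (NCPoly κ) where
  star_smul c p := by
    rw [Algebra.smul_def, star_mul, Algebra.smul_def, Algebra.commutes]
    congr 1
    exact (congrArg star (conjCoeff_algebraMap c)).trans (FreeAlgebra.star_algebraMap _)
end NCPoly


namespace QGaussian

/-- The complexification `ℂ ⊗ E` of a real inner product space. -/
def Cpx (E : Type*) [NormedAddCommGroup E] [InnerProductSpace ℝ E] : Type _ := ℂ ⊗[ℝ] E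

namespace Cpx
variable {E : Type*} [NormedAddCommGroup E] [InnerProductSpace ℝ E]

noncomputable instance : AddCommGroup (Cpx E) := inferInstanceAs (AddCommGroup (ℂ ⊗[ℝ] E))
noncomputable instance : Module ℂ (Cpx E) := inferInstanceAs (Module ℂ (ℂ ⊗[ℝ] E))
instance [FiniteDimensional ℝ E] : FiniteDimensional ℂ (Cpx E) :=
  inferInstanceAs (Module.Finite ℂ (ℂ ⊗[ℝ] E))

/-- The elementary tensor `z ⊗ x`. -/
noncomputable def mk (z : ℂ) (x : E) : Cpx E := z ⊗ₜ[ℝ] x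

theorem smul_mk (c z : ℂ) (x : E) : c • mk z x = mk (c * z) x :=
  TensorProduct.smul_tmul' c z x

@[elab_as_elim]
theorem ind {p : Cpx E → Prop} (u : Cpx E) (zero : p 0) (hmk : ∀ z x, p (mk z x))
    (add : ∀ u v, p u → p v → p (u + v)) : p u :=
  TensorProduct.induction_on u zero hmk add

/-- Real part: `z ⊗ x ↦ (re z) x`. -/
noncomputable def re : Cpx E →+ E :=
  ((TensorProduct.lid ℝ E).toLinearMap ∘ₗ
    TensorProduct.map Complex.reLm LinearMap.id : ℂ ⊗[ℝ] E →ₗ[ℝ] E).toAddMonoidHom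

/-- Imaginary part: `z ⊗ x ↦ (im z) x`. -/
noncomputable def im : Cpx E →+ E :=
  ((TensorProduct.lid ℝ E).toLinearMap ∘ₗ
    TensorProduct.map Complex.imLm LinearMap.id : ℂ ⊗[ℝ] E →ₗ[ℝ] E).toAddMonoidHom

theorem re_mk (z : ℂ) (x : E) : re (mk z x) = z.re • x :=
  (congrArg _ (TensorProduct.map_tmul ..)).trans (TensorProduct.lid_tmul ..)

theorem im_mk (z : ℂ) (x : E) : im (mk z x) = z.im • x :=
  (congrArg _ (TensorProduct.map_tmul ..)).trans (TensorProduct.lid_tmul ..)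

theorem re_smul (c : ℂ) (u : Cpx E) : re (c • u) = c.re • re u - c.im • im u := by
  induction u using ind with
  | zero => simp
  | hmk z x => simp [smul_mk, re_mk, im_mk, sub_smul, smul_smul]
  | add u v hu hv => simp only [smul_add, map_add, hu, hv]; abel

theorem im_smul (c : ℂ) (u : Cpx E) : im (c • u) = c.re • im u + c.im • re u := by
  induction u using ind with
  | zero => simp
  | hmk z x => simp [smul_mk, re_mk, im_mk, add_smul, smul_smul]
  | add u v hu hv => simp only [smul_add, map_add, hu, hv]; abel

theorem mk_re_add_mk_im (u : Cpx E) : mk 1 (re u) + mk Complex.I (im u) = u := by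
  have hadd (z : ℂ) (x y : E) : mk z (x + y) = mk z x + mk z y := TensorProduct.tmul_add z x y
  have hadd' (z w : ℂ) (x : E) : mk (z + w) x = mk z x + mk w x := TensorProduct.add_tmul z w x
  have hsm (z : ℂ) (r : ℝ) (x : E) : mk z (r • x) = mk (r • z) x :=
    (TensorProduct.smul_tmul r z x).symm
  induction u using ind with
  | zero =>
    have h0 (z : ℂ) : mk z (0 : E) = 0 := TensorProduct.tmul_zero E z
    simp [h0]
  | hmk z x =>
    rw [re_mk, im_mk, hsm, hsm, ← hadd']
    congr 1
    apply Complex.ext <;> simp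
  | add u v hu hv =>
    rw [map_add, map_add, hadd, hadd, add_add_add_comm, hu, hv]

/-- The inner product with `⟪z ⊗ x, w ⊗ y⟫ = conj z * w * ⟪x, y⟫` (see `inner_mk`). -/
@[reducible] noncomputable def core : InnerProductSpace.Core ℂ (Cpx E) where
  inner u v := ⟨inner ℝ (re u) (re v) + inner ℝ (im u) (im v),
    inner ℝ (re u) (im v) - inner ℝ (im u) (re v)⟩
  conj_inner_symm u v := by
    apply Complex.ext <;> simp [real_inner_comm]
  re_inner_nonneg u := add_nonneg real_inner_self_nonneg real_inner_self_nonneg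
  add_left u v w := by
    apply Complex.ext <;> simp [inner_add_left] <;> ring
  smul_left u v c := by
    apply Complex.ext <;>
      simp [re_smul, im_smul, inner_add_left, inner_sub_left, inner_smul_left] <;> ring
  definite u hu := by
    have h := congrArg Complex.re hu
    simp only [Complex.zero_re] at h
    have h1 : re u = 0 := inner_self_eq_zero (𝕜 := ℝ).1
      (le_antisymm (by linarith [real_inner_self_nonneg (x := im u)]) real_inner_self_nonneg)
    have h2 : im u = 0 := inner_self_eq_zero (𝕜 := ℝ).1
      (le_antisymm (by linarith [real_inner_self_nonneg (x := re u)]) real_inner_self_nonneg)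
    rw [← mk_re_add_mk_im u, h1, h2]
    exact (congrArg₂ _ (TensorProduct.tmul_zero E _) (TensorProduct.tmul_zero E _)).trans
      (add_zero _)

noncomputable instance : NormedAddCommGroup (Cpx E) := core.toNormedAddCommGroup
noncomputable instance : InnerProductSpace ℂ (Cpx E) := .ofCore core.toCore

theorem inner_mk (z w : ℂ) (x y : E) :
    inner ℂ (mk z x) (mk w y) = conj z * w * (inner ℝ x y : ℝ) := by
  change (⟨_, _⟩ : ℂ) = _
  rw [re_mk, re_mk, im_mk, im_mk]
  apply Complex.ext <;> simp [inner_smul_left, inner_smul_right] <;> ring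

end Cpx

section Perm

/-- The number `i(σ)` of inversions: pairs `a < b` with `σ a > σ b`. -/
def inversions {n : ℕ} (σ : Equiv.Perm (Fin n)) : ℕ :=
  (Finset.univ.filter fun p : Fin n × Fin n => p.1 < p.2 ∧ σ p.2 < σ p.1).card

theorem inv_symm {n : ℕ} (σ : Equiv.Perm (Fin n)) : inversions σ⁻¹ = inversions σ := by
  refine Finset.card_bij (fun p _ => (σ⁻¹ p.2, σ⁻¹ p.1)) ?_ ?_ ?_
  · simp +contextual
  · simp +contextual [Prod.ext_iff]
  · intro p hp
    refine ⟨(σ p.2, σ p.1), ?_, by simp⟩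
    simpa [and_comm] using hp

theorem pow_inv_eq_prod {R : Type*} [CommRing R] (q : R) {n : ℕ} (σ τ : Equiv.Perm (Fin n)) :
    q ^ inversions (τ * σ⁻¹) = ∏ p : Fin n × Fin n,
      if p.1 < p.2 ∧ ¬ (σ p.2 < σ p.1 ↔ τ p.2 < τ p.1) then q else 1 := by
  rw [Finset.prod_ite, Finset.prod_const, Finset.prod_const_one, mul_one]
  congr 1
  unfold inversions
  refine Finset.card_bij (fun p _ => if σ⁻¹ p.1 < σ⁻¹ p.2 then (σ⁻¹ p.1, σ⁻¹ p.2)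
    else (σ⁻¹ p.2, σ⁻¹ p.1)) ?_ ?_ ?_
  · rintro ⟨a, b⟩ h
    rw [Finset.mem_filter] at h ⊢
    simp only [Finset.mem_univ, true_and, Equiv.Perm.mul_apply] at h ⊢
    split_ifs with h1
    · refine ⟨h1, ?_⟩
      simpa [h.1.not_gt] using h.2
    · have : σ⁻¹ a ≠ σ⁻¹ b := fun e => h.1.ne (σ⁻¹.injective e)
      refine ⟨lt_of_le_of_ne (not_lt.1 h1) this.symm, ?_⟩
      simpa [h.1] using h.2.le
  · rintro ⟨a, b⟩ h ⟨c, d⟩ h'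
    simp only [Finset.mem_filter, Finset.mem_univ, true_and] at h h' ⊢
    have := h.1.not_gt
    have := h'.1.not_gt
    split_ifs <;> simp <;> rintro rfl rfl <;> tauto
  · rintro ⟨a, b⟩ h
    simp only [Finset.mem_filter, Finset.mem_univ, true_and] at h
    obtain ⟨hab, h⟩ := h
    have hσ : σ a ≠ σ b := fun e => hab.ne (σ.injective e)
    have hτ : τ a ≠ τ b := fun e => hab.ne (τ.injective e)
    rcases lt_or_gt_of_ne hσ with h1 | h1
    · refine ⟨(σ a, σ b), ?_, by simp [hab]⟩
      rw [Finset.mem_filter]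
      simp only [Finset.mem_univ, true_and, Equiv.Perm.mul_apply,
        Equiv.Perm.coe_inv, Equiv.symm_apply_apply]
      exact ⟨h1, by simpa [h1.not_gt] using h⟩
    · refine ⟨(σ b, σ a), ?_, by simp [hab.not_gt]⟩
      rw [Finset.mem_filter]
      simp only [Finset.mem_univ, true_and, Equiv.Perm.mul_apply,
        Equiv.Perm.coe_inv, Equiv.symm_apply_apply]
      exact ⟨h1, lt_of_le_of_ne (by simpa [h1] using h) hτ⟩

/-- The kernel `q ^ i(τ σ⁻¹)` on the permutations is positive semidefinite. -/
theorem exists_gram (q : ℝ) (hq : -1 ≤ q) (hq' : q ≤ 1) (n : ℕ) :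
    ∃ v : (Fin n × Fin n → Bool) → Equiv.Perm (Fin n) → ℝ,
      ∀ σ τ, q ^ inversions (τ * σ⁻¹) = ∑ k, v k σ * v k τ := by
  have hs : 0 ≤ 1 - q ^ 2 := by nlinarith
  let w (p : Fin n × Fin n) (b : Bool) (σ : Equiv.Perm (Fin n)) : ℝ :=
    if p.1 < p.2 then
      (if σ p.2 < σ p.1 then (if b then √(1 - q ^ 2) else q) else (if b then 0 else 1))
    else (if b then 0 else 1)
  refine ⟨fun k σ => ∏ p, w p (k p) σ, fun σ τ => ?_⟩
  simp_rw [← Finset.prod_mul_distrib]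
  rw [pow_inv_eq_prod, ← Fintype.prod_sum (fun p b => w p b σ * w p b τ)]
  refine Finset.prod_congr rfl fun p _ => ?_
  have := Real.mul_self_sqrt hs
  simp only [w, Fintype.sum_bool]
  by_cases h1 : p.1 < p.2 <;> by_cases h2 : σ p.2 < σ p.1 <;> by_cases h3 : τ p.2 < τ p.1 <;>
    simp [h1, h2, h3, this]
  ring

/-- The permutation that sends `k` to `0` and acts as `τ` on the rest. -/
def insPerm {n : ℕ} (k : Fin (n + 1)) (τ : Equiv.Perm (Fin n)) : Equiv.Perm (Fin (n + 1)) :=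
  Equiv.Perm.decomposeFin.symm (0, τ) * k.cycleRange

theorem insPerm_self {n : ℕ} (k : Fin (n + 1)) (τ : Equiv.Perm (Fin n)) : insPerm k τ k = 0 := by
  simp [insPerm]

theorem insPerm_succAbove {n : ℕ} (k : Fin (n + 1)) (τ : Equiv.Perm (Fin n)) (j : Fin n) :
    insPerm k τ (k.succAbove j) = (τ j).succ := by
  simp [insPerm]

theorem insPerm_bijective (n : ℕ) :
    Function.Bijective fun p : Fin (n + 1) × Equiv.Perm (Fin n) => insPerm p.1 p.2 := by
  rw [Fintype.bijective_iff_injective_and_card]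
  constructor
  · rintro ⟨k, τ⟩ ⟨k', τ'⟩ h
    have h : insPerm k τ = insPerm k' τ' := h
    obtain rfl : k = k' := (insPerm k τ).injective
      ((insPerm_self k τ).trans ((h ▸ insPerm_self k' τ').symm))
    congr 1
    ext j : 1
    have := congrArg (fun σ => σ (k.succAbove j)) h
    simpa [insPerm_succAbove] using this
  · simp [Fintype.card_perm, Nat.factorial_succ]

theorem inv_insPerm {n : ℕ} (k : Fin (n + 1)) (τ : Equiv.Perm (Fin n)) :
    inversions (insPerm k τ) = k + inversions τ := by
  simp only [inversions, Finset.card_filter, Fintype.sum_prod_type]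
  rw [Fin.sum_univ_succAbove _ k]
  simp only [Fin.sum_univ_succAbove _ k, insPerm_self, insPerm_succAbove, Finset.sum_add_distrib]
  simp only [Fin.not_lt_zero, and_false, if_false, Finset.sum_const_zero, zero_add,
    Fin.succ_lt_succ_iff, Fin.succ_pos, and_true, (Fin.strictMono_succAbove k).lt_iff_lt]
  congr 1
  rw [← Finset.card_filter]
  rw [Finset.filter_congr (q := fun j : Fin n => (j : ℕ) < k)
    (fun j _ => by rw [Fin.succAbove_lt_iff_castSucc_lt, Fin.lt_def, Fin.val_castSucc]),
    Fin.card_filter_val_lt]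
  omega

end Perm

section Tensor

variable {H : Type*} [NormedAddCommGroup H] [InnerProductSpace ℂ H]

theorem form_ext {n m : ℕ} {B B' : (⨂[ℂ]^n H) →ₗ⋆[ℂ] (⨂[ℂ]^m H) →ₗ[ℂ] ℂ}
    (h : ∀ x y, B (PiTensorProduct.tprod ℂ x) (PiTensorProduct.tprod ℂ y) =
      B' (PiTensorProduct.tprod ℂ x) (PiTensorProduct.tprod ℂ y)) : B = B' := by
  refine LinearMap.ext fun x => LinearMap.ext fun y => ?_
  induction x using PiTensorProduct.induction_on with
  | smul_tprod r x =>
    induction y using PiTensorProduct.induction_on with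
    | smul_tprod s y => simp [h]
    | add y y' hy hy' => rw [map_add, map_add, hy, hy']
  | add x x' hx hx' => rw [map_add, map_add, LinearMap.add_apply, LinearMap.add_apply, hx, hx']

/-- `ξ₁ ⊗ … ⊗ ξₙ ↦ ξ_{σ(1)} ⊗ … ⊗ ξ_{σ(n)}`. -/
noncomputable def permute {n : ℕ} (σ : Equiv.Perm (Fin n)) : (⨂[ℂ]^n H) →ₗ[ℂ] (⨂[ℂ]^n H) :=
  (PiTensorProduct.reindex ℂ (fun _ => H) σ.symm).toLinearMap

theorem permute_tprod {n : ℕ} (σ : Equiv.Perm (Fin n)) (x : Fin n → H) :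
    permute σ (PiTensorProduct.tprod ℂ x) = PiTensorProduct.tprod ℂ fun i => x (σ i) :=
  PiTensorProduct.reindex_tprod _ _

theorem permute_mul {n : ℕ} (σ τ : Equiv.Perm (Fin n)) (x : ⨂[ℂ]^n H) :
    permute (σ * τ) x = permute τ (permute σ x) := by
  induction x using PiTensorProduct.induction_on with
  | smul_tprod r x => simp [permute_tprod]
  | add x y hx hy => rw [map_add, map_add, map_add, hx, hy]

theorem permute_inv_cancel {n : ℕ} (σ : Equiv.Perm (Fin n)) (x : ⨂[ℂ]^n H) :
    permute σ (permute σ⁻¹ x) = x := by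
  rw [← permute_mul]
  induction x using PiTensorProduct.induction_on with
  | smul_tprod r x => simp [permute_tprod]
  | add x y hx hy => rw [map_add, hx, hy]

/-- The symmetrization operator `P_q^n`: `∑ σ, q ^ i(σ) ξ_{σ(1)} ⊗ … ⊗ ξ_{σ(n)}`. -/
noncomputable def symmetrizer (q : ℝ) (n : ℕ) : (⨂[ℂ]^n H) →ₗ[ℂ] (⨂[ℂ]^n H) :=
  ∑ σ : Equiv.Perm (Fin n), (q : ℂ) ^ inversions σ • permute σ

theorem symmetrizer_tprod (q : ℝ) {n : ℕ} (x : Fin n → H) :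
    symmetrizer q n (PiTensorProduct.tprod ℂ x) =
      ∑ σ : Equiv.Perm (Fin n), (q : ℂ) ^ inversions σ • PiTensorProduct.tprod ℂ fun i => x (σ i) := by
  simp [symmetrizer, permute_tprod]

/-- `ξ₁ ⊗ … ⊗ ξₙ ↦ ξ ⊗ ξ₁ ⊗ … ⊗ ξₙ`. -/
noncomputable def cons (ξ : H) (n : ℕ) : (⨂[ℂ]^n H) →ₗ[ℂ] (⨂[ℂ]^(n + 1) H) :=
  PiTensorProduct.lift
    ((PiTensorProduct.tprod ℂ : MultilinearMap ℂ (fun _ : Fin (n + 1) => H) _).curryLeft ξ)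

theorem cons_tprod (ξ : H) {n : ℕ} (x : Fin n → H) :
    cons ξ n (PiTensorProduct.tprod ℂ x) =
      PiTensorProduct.tprod ℂ (Fin.cons ξ x : Fin (n + 1) → H) :=
  PiTensorProduct.lift.tprod _

/-- `ξ₀ ⊗ … ⊗ ξₙ ↦ ⟪ξ, ξ₀⟫ ξ₁ ⊗ … ⊗ ξₙ`. -/
noncomputable def contractLeft (ξ : H) (n : ℕ) : (⨂[ℂ]^(n + 1) H) →ₗ[ℂ] (⨂[ℂ]^n H) :=
  PiTensorProduct.lift
    (LinearMap.uncurryLeft (M := fun _ : Fin (n + 1) => H)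
      ((innerSL ℂ ξ).toLinearMap.smulRight (PiTensorProduct.tprod ℂ)))

theorem contractLeft_tprod (ξ : H) {n : ℕ} (x : Fin (n + 1) → H) :
    contractLeft ξ n (PiTensorProduct.tprod ℂ x) =
      inner ℂ ξ (x 0) • PiTensorProduct.tprod ℂ fun i => x i.succ :=
  PiTensorProduct.lift.tprod _

/-- The formal adjoint of `cons ξ n` for the `q`-deformed inner products. -/
noncomputable def annih (q : ℝ) (ξ : H) (n : ℕ) : (⨂[ℂ]^(n + 1) H) →ₗ[ℂ] (⨂[ℂ]^n H) :=
  ∑ k : Fin (n + 1), (q : ℂ) ^ (k : ℕ) • contractLeft ξ n ∘ₗ permute k.cycleRange.symm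

theorem annih_tprod (q : ℝ) (ξ : H) {n : ℕ} (x : Fin (n + 1) → H) :
    annih q ξ n (PiTensorProduct.tprod ℂ x) =
      ∑ k : Fin (n + 1), ((q : ℂ) ^ (k : ℕ) * inner ℂ ξ (x k)) •
        PiTensorProduct.tprod ℂ fun i => x (k.succAbove i) := by
  simp [annih, permute_tprod, contractLeft_tprod, smul_smul]

theorem annih_cons_zero (q : ℝ) (ξ : H) (x : ⨂[ℂ]^0 H) :
    annih q ξ 0 (cons ξ 0 x) = inner ℂ ξ ξ • x := by
  induction x using PiTensorProduct.induction_on with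
  | smul_tprod r x =>
    simp [annih_tprod, cons_tprod, smul_comm r]
  | add x y hx hy => simp only [map_add, smul_add, hx, hy]

theorem annih_cons_succ (q : ℝ) (ξ : H) {n : ℕ} (x : ⨂[ℂ]^(n + 1) H) :
    annih q ξ (n + 1) (cons ξ (n + 1) x) =
      inner ℂ ξ ξ • x + (q : ℂ) • cons ξ n (annih q ξ n x) := by
  induction x using PiTensorProduct.induction_on with
  | smul_tprod r x =>
    simp only [map_smul]
    rw [smul_comm _ r, smul_comm _ r, ← smul_add]
    congr 1
    rw [cons_tprod, annih_tprod, annih_tprod, Fin.sum_univ_succ, map_sum, Finset.smul_sum]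
    congr 1
    · simp
    · refine Finset.sum_congr rfl fun k _ => ?_
      rw [map_smul, cons_tprod, smul_smul]
      congr 1
      · simp [pow_succ']; ring
      · congr 1
        funext i
        cases i using Fin.cases <;> simp
  | add x y hx hy => simp only [map_add, smul_add, hx, hy]; abel

end Tensor

section Form

variable {H : Type*} [NormedAddCommGroup H] [InnerProductSpace ℂ H] [FiniteDimensional ℂ H]

/-- The basis of elementary tensors of orthonormal basis vectors. -/
noncomputable def tensorBasis (H : Type*) [NormedAddCommGroup H] [InnerProductSpace ℂ H]
    [FiniteDimensional ℂ H] (n : ℕ) :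
    Module.Basis (Fin n → Fin (Module.finrank ℂ H)) ℂ (⨂[ℂ]^n H) :=
  Basis.piTensorProduct fun _ => (stdOrthonormalBasis ℂ H).toBasis

/-- The usual (undeformed) inner product on `H^{⊗ n}`, in which the tensors of orthonormal basis
vectors are orthonormal; by `tensorInner_tprod` it does not depend on the basis. -/
noncomputable def tensorInner (n : ℕ) : (⨂[ℂ]^n H) →ₗ⋆[ℂ] (⨂[ℂ]^n H) →ₗ[ℂ] ℂ :=
  LinearMap.mk₂'ₛₗ _ _
    (fun x y => ∑ p, conj ((tensorBasis H n).repr x p) * (tensorBasis H n).repr y p)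
    (fun x x' y => by simp [add_mul, Finset.sum_add_distrib])
    (fun c x y => by simp [Finset.mul_sum, mul_assoc])
    (fun x y y' => by simp [mul_add, Finset.sum_add_distrib])
    (fun c x y => by simp [Finset.mul_sum, mul_left_comm])

theorem tensorInner_apply {n : ℕ} (x y : ⨂[ℂ]^n H) : tensorInner n x y =
    ∑ p, conj ((tensorBasis H n).repr x p) * (tensorBasis H n).repr y p := rfl

theorem tensorInner_tprod {n : ℕ} (x y : Fin n → H) :
    tensorInner n (PiTensorProduct.tprod ℂ x) (PiTensorProduct.tprod ℂ y) =
      ∏ i, inner ℂ (x i) (y i) := by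
  rw [tensorInner_apply]
  simp only [tensorBasis, Basis.piTensorProduct_repr_tprod_apply, map_prod,
    ← Finset.prod_mul_distrib]
  rw [← Fintype.prod_sum (fun i j => conj ((stdOrthonormalBasis ℂ H).toBasis.repr (x i) j) *
    (stdOrthonormalBasis ℂ H).toBasis.repr (y i) j)]
  refine Finset.prod_congr rfl fun i _ => ?_
  rw [← (stdOrthonormalBasis ℂ H).sum_inner_mul_inner (x i) (y i)]
  refine Finset.sum_congr rfl fun j _ => ?_
  simp [OrthonormalBasis.repr_apply_apply]

theorem tensorInner_conj {n : ℕ} (x y : ⨂[ℂ]^n H) :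
    conj (tensorInner n y x) = tensorInner n x y := by
  simp [tensorInner_apply, mul_comm]

theorem tensorInner_self_nonneg {n : ℕ} (x : ⨂[ℂ]^n H) : 0 ≤ (tensorInner n x x).re := by
  rw [tensorInner_apply, Complex.re_sum]
  refine Finset.sum_nonneg fun p _ => ?_
  rw [mul_comm, Complex.mul_conj, Complex.ofReal_re]
  exact Complex.normSq_nonneg _

/-- The `q`-deformed inner product `⟪ξ, η⟫_q = ⟪P_q^n ξ, η⟫` on `H^{⊗ n}`. -/
noncomputable def qForm (q : ℝ) (n : ℕ) : (⨂[ℂ]^n H) →ₗ⋆[ℂ] (⨂[ℂ]^n H) →ₗ[ℂ] ℂ :=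
  (tensorInner n).comp (symmetrizer q n)

theorem qForm_eq_sum (q : ℝ) {n : ℕ} (x y : ⨂[ℂ]^n H) :
    qForm q n x y = ∑ σ, (q : ℂ) ^ inversions σ * tensorInner n (permute σ x) y := by
  simp [qForm, symmetrizer]

theorem tensorInner_permute {n : ℕ} (σ : Equiv.Perm (Fin n)) (x y : ⨂[ℂ]^n H) :
    tensorInner n (permute σ x) (permute σ y) = tensorInner n x y := by
  have : ((tensorInner n).comp (permute σ)).compl₂ (permute σ) = tensorInner (H := H) n := by
    refine form_ext fun x y => ?_
    simp only [LinearMap.compl₂_apply, LinearMap.comp_apply, permute_tprod, tensorInner_tprod]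
    exact Equiv.prod_comp σ (fun i => inner ℂ (x i) (y i))
  exact congrArg (fun B => B x y) this

theorem qForm_conj (q : ℝ) {n : ℕ} (x y : ⨂[ℂ]^n H) :
    conj (qForm q n y x) = qForm q n x y := by
  rw [qForm_eq_sum, qForm_eq_sum, map_sum, ← Equiv.sum_comp (Equiv.inv _)]
  refine Finset.sum_congr rfl fun σ _ => ?_
  rw [map_mul, tensorInner_conj, map_pow, Complex.conj_ofReal, Equiv.inv_apply, inv_symm,
    ← tensorInner_permute σ, permute_inv_cancel]

theorem qForm_self_nonneg {q : ℝ} (hq : -1 ≤ q) (hq' : q ≤ 1) {n : ℕ} (x : ⨂[ℂ]^n H) :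
    0 ≤ (qForm q n x x).re := by
  obtain ⟨v, hv⟩ := exists_gram q hq hq' n
  have key : (n.factorial : ℂ) * qForm q n x x = ∑ k, tensorInner n
      (∑ τ, (v k τ : ℂ) • permute τ x) (∑ σ, (v k σ : ℂ) • permute σ x) := by
    have h1 (σ : Equiv.Perm (Fin n)) : qForm q n x x =
        ∑ τ, ((∑ k, v k σ * v k τ : ℝ) : ℂ) * tensorInner n (permute τ x) (permute σ x) := by
      rw [qForm_eq_sum, ← Equiv.sum_comp (Equiv.mulRight σ⁻¹)]
      refine Finset.sum_congr rfl fun τ _ => ?_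
      rw [Equiv.coe_mulRight, ← hv σ τ, Complex.ofReal_pow, ← tensorInner_permute σ,
        ← permute_mul, inv_mul_cancel_right]
    calc (n.factorial : ℂ) * qForm q n x x
        = ∑ _σ : Equiv.Perm (Fin n), qForm q n x x := by
          simp [Fintype.card_perm]
      _ = _ := by
          rw [Finset.sum_congr rfl fun σ _ => h1 σ]
          simp only [map_sum, LinearMap.sum_apply, map_smulₛₗ, LinearMap.smul_apply, smul_eq_mul,
            Complex.ofReal_sum, Complex.ofReal_mul, Finset.sum_mul, Complex.conj_ofReal,
            RingHom.id_apply]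
          simp only [Finset.mul_sum]
          conv_rhs => rw [Finset.sum_comm]
          refine Finset.sum_congr rfl fun σ _ => ?_
          rw [Finset.sum_comm]
          simp only [mul_assoc]
  have h2 := congrArg Complex.re key
  rw [← Complex.ofReal_natCast, Complex.re_ofReal_mul, Complex.re_sum] at h2
  have h3 : 0 ≤ (n.factorial : ℝ) * (qForm q n x x).re :=
    h2 ▸ Finset.sum_nonneg fun k _ => tensorInner_self_nonneg _
  exact nonneg_of_mul_nonneg_right h3 (by exact_mod_cast n.factorial_pos)

theorem qForm_cons (q : ℝ) (ξ : H) {n : ℕ} (x : ⨂[ℂ]^n H) (y : ⨂[ℂ]^(n + 1) H) :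
    qForm q (n + 1) (cons ξ n x) y = qForm q n x (annih q ξ n y) := by
  have : (qForm q (n + 1)).comp (cons ξ n) = (qForm q n).compl₂ (annih q ξ n) := by
    refine form_ext fun x y => ?_
    simp only [LinearMap.compl₂_apply, LinearMap.comp_apply, cons_tprod, annih_tprod, map_sum,
      map_smul, smul_eq_mul, qForm_eq_sum, permute_tprod, tensorInner_tprod]
    rw [← (insPerm_bijective n).sum_comp, Fintype.sum_prod_type]
    refine Finset.sum_congr rfl fun k _ => ?_
    rw [Finset.mul_sum]
    refine Finset.sum_congr rfl fun τ _ => ?_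
    rw [inv_insPerm, Fin.prod_univ_succAbove _ k]
    simp only [insPerm_self, insPerm_succAbove, Fin.cons_zero, Fin.cons_succ]
    ring
  exact congrArg (fun B => B x y) this

end Form

section Fock

/-- The algebraic `q`-Fock space: the algebraic direct sum of all `H^{⊗ n}`, where `H^{⊗ 0} = ℂ Ω`. -/
def AlgFock (_q : Set.Ioo (-1 : ℝ) 1) (H : Type*) [NormedAddCommGroup H] [InnerProductSpace ℂ H] :
    Type _ :=
  DirectSum ℕ fun n => ⨂[ℂ]^n H

namespace AlgFock

variable {q : Set.Ioo (-1 : ℝ) 1} {H : Type*} [NormedAddCommGroup H] [InnerProductSpace ℂ H]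

noncomputable instance : AddCommGroup (AlgFock q H) :=
  inferInstanceAs (AddCommGroup (DirectSum ℕ fun n => ⨂[ℂ]^n H))
noncomputable instance : Module ℂ (AlgFock q H) :=
  inferInstanceAs (Module ℂ (DirectSum ℕ fun n => ⨂[ℂ]^n H))

/-- The inclusion of `H^{⊗ n}`. -/
noncomputable def of (q : Set.Ioo (-1 : ℝ) 1) (n : ℕ) : (⨂[ℂ]^n H) →ₗ[ℂ] AlgFock q H :=
  DirectSum.lof ℂ ℕ (fun n => ⨂[ℂ]^n H) n

/-- The component in `H^{⊗ n}`. -/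
noncomputable def component (n : ℕ) : AlgFock q H →ₗ[ℂ] (⨂[ℂ]^n H) :=
  DirectSum.component ℂ ℕ (fun n => ⨂[ℂ]^n H) n

/-- The linear map given by linear maps on all `H^{⊗ n}`. -/
noncomputable def lift {M : Type*} [AddCommGroup M] [Module ℂ M] (f : ∀ n, (⨂[ℂ]^n H) →ₗ[ℂ] M) :
    AlgFock q H →ₗ[ℂ] M :=
  DirectSum.toModule ℂ ℕ M f

theorem lift_of {M : Type*} [AddCommGroup M] [Module ℂ M] (f : ∀ n, (⨂[ℂ]^n H) →ₗ[ℂ] M)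
    (n : ℕ) (x : ⨂[ℂ]^n H) : lift f (of q n x) = f n x :=
  DirectSum.toModule_lof (M := fun n => ⨂[ℂ]^n H) ℂ n x

theorem component_of_self (n : ℕ) (x : ⨂[ℂ]^n H) : component n (of q n x) = x :=
  DirectSum.component.lof_self (M := fun n => ⨂[ℂ]^n H) ℂ n x

theorem component_of_ne {n m : ℕ} (h : n ≠ m) (x : ⨂[ℂ]^n H) : component m (of q n x) = 0 :=
  (DirectSum.component.of (M := fun n => ⨂[ℂ]^n H) ℂ m n x).trans (dif_neg h)

theorem exists_eq_sum (x : AlgFock q H) :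
    ∃ N, x = ∑ n ∈ Finset.range N, of q n (component n x) := by
  classical
  refine ⟨(DFinsupp.support (β := fun n => ⨂[ℂ]^n H) x).sup id + 1, ?_⟩
  refine DFinsupp.ext (β := fun n => ⨂[ℂ]^n H) fun m => ?_
  change component m x = component m _
  rw [map_sum]
  by_cases hm : component m x = 0
  · refine hm.trans (Eq.symm (Finset.sum_eq_zero fun n _ => ?_))
    by_cases h : n = m
    · subst h; rw [component_of_self, hm]
    · exact component_of_ne h _
  · rw [Finset.sum_eq_single m, component_of_self]
    · exact fun n _ h => component_of_ne h _
    · intro h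
      exact absurd (Finset.mem_range.2 (Nat.lt_succ_of_le (Finset.le_sup (f := id)
        ((DFinsupp.mem_support_iff (β := fun n => ⨂[ℂ]^n H)).2 hm)))) h

@[elab_as_elim]
theorem ind {p : AlgFock q H → Prop} (x : AlgFock q H) (zero : p 0)
    (hof : ∀ n y, p (of q n y)) (add : ∀ x y, p x → p y → p (x + y)) : p x :=
  DirectSum.induction_on x zero hof add

/-- The left creation operator `ξ₁ ⊗ … ⊗ ξₙ ↦ ξ ⊗ ξ₁ ⊗ … ⊗ ξₙ` on the algebraic Fock space. -/
noncomputable def create (ξ : H) : AlgFock q H →ₗ[ℂ] AlgFock q H :=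
  lift fun n => of q (n + 1) ∘ₗ cons ξ n

theorem create_of (ξ : H) {n : ℕ} (x : ⨂[ℂ]^n H) :
    create ξ (of q n x) = of q (n + 1) (cons ξ n x) :=
  lift_of _ _ _

variable [FiniteDimensional ℂ H]

/-- The `q`-deformed inner product, with `H^{⊗ n}` and `H^{⊗ m}` orthogonal for `n ≠ m`. -/
noncomputable def form : AlgFock q H → AlgFock q H → ℂ :=
  fun x => lift fun n => qForm (q : ℝ) n (component n x)

theorem form_of (x : AlgFock q H) (n : ℕ) (y : ⨂[ℂ]^n H) :
    form x (of q n y) = qForm q n (component n x) y := lift_of _ _ _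

theorem form_add_right (x y y' : AlgFock q H) : form x (y + y') = form x y + form x y' :=
  map_add _ _ _

theorem form_add_left (x x' y : AlgFock q H) : form (x + x') y = form x y + form x' y := by
  induction y using ind with
  | zero => simp [form]
  | hof n y => simp [form_of]
  | add y y' h h' => simp only [form_add_right, h, h']; ring

theorem form_smul_left (x y : AlgFock q H) (c : ℂ) : form (c • x) y = conj c * form x y := by
  induction y using ind with
  | zero => simp [form]
  | hof n y => simp [form_of]
  | add y y' h h' => simp only [form_add_right, h, h']; ring

theorem form_of_of (n : ℕ) (x y : ⨂[ℂ]^n H) : form (of q n x) (of q n y) = qForm q n x y := by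
  rw [form_of, component_of_self]

theorem form_of_of_ne {n m : ℕ} (h : n ≠ m) (x : ⨂[ℂ]^n H) (y : ⨂[ℂ]^m H) :
    form (of q n x) (of q m y) = 0 := by
  rw [form_of, component_of_ne h]; simp

theorem form_conj (x y : AlgFock q H) : conj (form y x) = form x y := by
  induction y using ind with
  | zero => 
    have : form (0 : AlgFock q H) x = 0 := by simpa using form_smul_left 0 x 0
    rw [this]; simp [form]
  | hof n y =>
    induction x using ind with
    | zero =>
      have : form (0 : AlgFock q H) (of q n y) = 0 := by simpa using form_smul_left 0 (of q n y) 0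
      rw [this]; simp [form]
    | hof m x =>
      by_cases h : n = m
      · subst h; rw [form_of_of, form_of_of, qForm_conj]
      · rw [form_of_of_ne h, form_of_of_ne (Ne.symm h), map_zero]
    | add x x' hx hx' => rw [form_add_right, form_add_left, map_add, hx, hx']
  | add y y' hy hy' => rw [form_add_right, form_add_left, map_add, hy, hy']

theorem form_self_nonneg (x : AlgFock q H) : 0 ≤ (form x x).re := by
  obtain ⟨N, hN⟩ := exists_eq_sum x
  have h : form x x = ∑ n ∈ Finset.range N, qForm q n (component n x) (component n x) := by
    conv_lhs => rw [hN]
    rw [← hN, form, hN, map_sum, ← hN]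
    exact Finset.sum_congr rfl fun n _ => form_of _ _ _
  rw [h, Complex.re_sum]
  exact Finset.sum_nonneg fun n _ => qForm_self_nonneg q.2.1.le q.2.2.le _

@[reducible] noncomputable def core : PreInnerProductSpace.Core ℂ (AlgFock q H) where
  inner := form
  conj_inner_symm := form_conj
  re_inner_nonneg := form_self_nonneg
  add_left := form_add_left
  smul_left := form_smul_left

noncomputable instance : SeminormedAddCommGroup (AlgFock q H) :=
  InnerProductSpace.Core.toSeminormedAddCommGroup (c := core)
noncomputable instance : InnerProductSpace ℂ (AlgFock q H) := .ofCore core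

theorem inner_of_of (n : ℕ) (x y : ⨂[ℂ]^n H) :
    inner ℂ (of q n x) (of q n y) = qForm q n x y := form_of_of n x y

theorem inner_of_of_ne {n m : ℕ} (h : n ≠ m) (x : ⨂[ℂ]^n H) (y : ⨂[ℂ]^m H) :
    inner ℂ (of q n x) (of q m y) = 0 := form_of_of_ne h x y

theorem norm_sum_sq (N : ℕ) (k : ℕ → ℕ) (hk : Function.Injective k)
    (g : ∀ n, ⨂[ℂ]^(k n) H) :
    ‖∑ n ∈ Finset.range N, of q (k n) (g n)‖ ^ 2 =
      ∑ n ∈ Finset.range N, ‖of q (k n) (g n)‖ ^ 2 := by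
  induction N with
  | zero => simp
  | succ N ih =>
    rw [Finset.sum_range_succ, Finset.sum_range_succ, norm_add_sq (𝕜 := ℂ), ih, sum_inner,
      Finset.sum_eq_zero fun n hn => inner_of_of_ne
        (fun h => (Finset.mem_range.1 hn).ne (hk h)) _ _]
    simp

theorem norm_cons_sq_le (ξ : H) (n : ℕ) (x : ⨂[ℂ]^n H) :
    ‖of q (n + 1) (cons ξ n x)‖ ^ 2 ≤ ‖ξ‖ ^ 2 / (1 - |(q : ℝ)|) * ‖of q n x‖ ^ 2 := by
  have hq : 0 < 1 - |(q : ℝ)| := sub_pos.2 (abs_lt.2 q.2)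
  have hC0 : 0 ≤ ‖ξ‖ ^ 2 / (1 - |(q : ℝ)|) := by positivity
  have hC : ‖ξ‖ ^ 2 + |(q : ℝ)| * (‖ξ‖ ^ 2 / (1 - |(q : ℝ)|)) = ‖ξ‖ ^ 2 / (1 - |(q : ℝ)|) := by
    field_simp; ring
  set C := ‖ξ‖ ^ 2 / (1 - |(q : ℝ)|) with hCdef
  have hadj (m : ℕ) (x : ⨂[ℂ]^m H) (y : ⨂[ℂ]^(m + 1) H) :
      inner ℂ (of q (m + 1) (cons ξ m x)) (of q (m + 1) y) =
        inner ℂ (of q m x) (of q m (annih q ξ m y)) := by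
    rw [inner_of_of, inner_of_of, qForm_cons]
  have hsq (m : ℕ) (x : ⨂[ℂ]^m H) : ‖of q m x‖ ^ 2 = (inner ℂ (of q m x) (of q m x)).re :=
    norm_sq_eq_re_inner (𝕜 := ℂ) _
  have hself : inner ℂ ξ ξ = ((‖ξ‖ ^ 2 : ℝ) : ℂ) := by
    rw [inner_self_eq_norm_sq_to_K]; simp
  induction n with
  | zero =>
    rw [hsq, hadj, annih_cons_zero, map_smul, inner_smul_right, hself, Complex.re_ofReal_mul, ← hsq]
    refine mul_le_mul_of_nonneg_right ?_ (sq_nonneg _)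
    rw [← hC]
    have := mul_nonneg (abs_nonneg (q : ℝ)) hC0
    linarith
  | succ n ih =>
    have ha : ‖of q n (annih q ξ n x)‖ ^ 2 ≤ C * ‖of q (n + 1) x‖ ^ 2 := by
      set y := annih q ξ n x
      have h1 : ‖of q n y‖ ^ 2 ≤ ‖of q (n + 1) (cons ξ n y)‖ * ‖of q (n + 1) x‖ := by
        rw [hsq, ← hadj]
        exact (Complex.re_le_norm _).trans (norm_inner_le_norm _ _)
      have h2 := ih y
      rcases eq_or_lt_of_le (norm_nonneg (of q n y)) with h0 | h0
      · rw [← h0, zero_pow two_ne_zero]; exact mul_nonneg hC0 (sq_nonneg _)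
      · have h3 : (‖of q n y‖ ^ 2) ^ 2 ≤ (C * ‖of q n y‖ ^ 2) * ‖of q (n + 1) x‖ ^ 2 := by
          calc _ ≤ (‖of q (n + 1) (cons ξ n y)‖ * ‖of q (n + 1) x‖) ^ 2 := by gcongr
            _ = ‖of q (n + 1) (cons ξ n y)‖ ^ 2 * ‖of q (n + 1) x‖ ^ 2 := by ring
            _ ≤ _ := by gcongr
        have h4 : 0 < ‖of q n y‖ ^ 2 := by positivity
        nlinarith
    have hadj' : inner ℂ (of q (n + 1) x) (of q (n + 1) (cons ξ n (annih q ξ n x))) =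
        ((‖of q n (annih q ξ n x)‖ ^ 2 : ℝ) : ℂ) := by
      rw [← inner_conj_symm, hadj, inner_self_eq_norm_sq_to_K]
      simp
    rw [hsq, hadj, annih_cons_succ, map_add, map_smul, map_smul, inner_add_right,
      inner_smul_right, inner_smul_right, hadj', inner_self_eq_norm_sq_to_K,
      inner_self_eq_norm_sq_to_K]
    have e : (((‖ξ‖ : ℂ) ^ 2 * (‖of q (n + 1) x‖ : ℂ) ^ 2 +
        ((q : ℝ) : ℂ) * ((‖of q n (annih q ξ n x)‖ ^ 2 : ℝ) : ℂ))).re =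
        ‖ξ‖ ^ 2 * ‖of q (n + 1) x‖ ^ 2 + q * ‖of q n (annih q ξ n x)‖ ^ 2 := by
      rw [← Complex.ofReal_re (‖ξ‖ ^ 2 * ‖of q (n + 1) x‖ ^ 2 + q * ‖of q n (annih q ξ n x)‖ ^ 2)]
      push_cast
      rfl
    refine e.le.trans ?_
    have h5 : (q : ℝ) * ‖of q n (annih q ξ n x)‖ ^ 2 ≤ |(q : ℝ)| * (C * ‖of q (n + 1) x‖ ^ 2) :=
      mul_le_mul (le_abs_self _) ha (sq_nonneg _) (abs_nonneg _)
    calc _ ≤ ‖ξ‖ ^ 2 * ‖of q (n + 1) x‖ ^ 2 + |(q : ℝ)| * (C * ‖of q (n + 1) x‖ ^ 2) := by gcongr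
      _ = (‖ξ‖ ^ 2 + |(q : ℝ)| * C) * ‖of q (n + 1) x‖ ^ 2 := by ring
      _ = _ := by rw [hC]

theorem norm_create_le (ξ : H) (x : AlgFock q H) :
    ‖create ξ x‖ ≤ √(‖ξ‖ ^ 2 / (1 - |(q : ℝ)|)) * ‖x‖ := by
  have hq : 0 < 1 - |(q : ℝ)| := sub_pos.2 (abs_lt.2 q.2)
  have hC0 : 0 ≤ ‖ξ‖ ^ 2 / (1 - |(q : ℝ)|) := by positivity
  obtain ⟨N, hN⟩ := exists_eq_sum x
  refine abs_le_of_sq_le_sq' ?_ (by positivity) |>.2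
  rw [mul_pow, Real.sq_sqrt hC0]
  conv_lhs => rw [hN, map_sum]
  conv_rhs => rw [hN]
  simp only [create_of]
  rw [norm_sum_sq N (fun n => n) Function.injective_id (fun n => component n x),
    norm_sum_sq N (fun n => n + 1) (add_left_injective 1)
      (fun n => cons ξ n (component n x)), Finset.mul_sum]
  exact Finset.sum_le_sum fun n _ => norm_cons_sq_le ξ n _

end AlgFock

/-- The `q`-Fock space `F_q(H)`: the Hilbert space completion of the algebraic Fock space. -/
abbrev FockSpace (q : Set.Ioo (-1 : ℝ) 1) (H : Type*) [NormedAddCommGroup H]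
    [InnerProductSpace ℂ H] [FiniteDimensional ℂ H] : Type _ :=
  UniformSpace.Completion (AlgFock q H)

/-- The left creation operator `l_q(ξ)` as a bounded operator on the `q`-Fock space. -/
noncomputable def creation (q : Set.Ioo (-1 : ℝ) 1) {H : Type*} [NormedAddCommGroup H]
    [InnerProductSpace ℂ H] [FiniteDimensional ℂ H] (ξ : H) : FockSpace q H →L[ℂ] FockSpace q H :=
  ((AlgFock.create ξ).mkContinuous _ (AlgFock.norm_create_le ξ)).completion

theorem creation_coe (q : Set.Ioo (-1 : ℝ) 1) {H : Type*} [NormedAddCommGroup H]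
    [InnerProductSpace ℂ H] [FiniteDimensional ℂ H] (ξ : H) (x : AlgFock q H) :
    creation q ξ (x : FockSpace q H) = (AlgFock.create ξ x : AlgFock q H) :=
  ContinuousLinearMap.completion_apply_coe _ _

end Fock

section Gaussian

variable (E : Type*) [NormedAddCommGroup E] [InnerProductSpace ℝ E] [FiniteDimensional ℝ E]

variable {E} in
/-- The `q`-Gaussian variable `l_q(x) + l_q(x)*` of a real vector `x`. -/
noncomputable def gaussianVar (q : Set.Ioo (-1 : ℝ) 1) (x : E) :
    FockSpace q (Cpx E) →L[ℂ] FockSpace q (Cpx E) :=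
  creation q (Cpx.mk 1 x) + star (creation q (Cpx.mk 1 x))

/-- The `q`-Gaussian `*`-algebra `𝒜_q`: the unital `*`-subalgebra of `B(F_q(H))` generated by the
operators `l_q(x) + l_q(x)*` with `x` in the real Hilbert space `E`; here `H` is the
complexification of `E`. -/
noncomputable def gaussianAlgebra (q : Set.Ioo (-1 : ℝ) 1) :
    StarSubalgebra ℂ (FockSpace q (Cpx E) →L[ℂ] FockSpace q (Cpx E)) :=
  StarAlgebra.adjoin ℂ (Set.range (gaussianVar (E := E) q))

variable {E} in
/-- The operator `l_q(x) + l_q(x)*` as an element of `𝒜_q`. -/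
noncomputable def gen (q : Set.Ioo (-1 : ℝ) 1) (x : E) : gaussianAlgebra E q :=
  ⟨gaussianVar q x, StarAlgebra.subset_adjoin ℂ _ (Set.mem_range_self x)⟩

end Gaussian

end QGaussian

-- Everything rests on the freeness of `𝒜_q`. Applied to the vacuum, a word `s_q(e_{w(1)}) …
-- s_q(e_{w(n)})` gives `e_{w(1)} ⊗ … ⊗ e_{w(n)}` plus terms of lower degree, because annihilation
-- lowers the degree. In a polynomial, the coefficient of a longest word therefore survives as a
-- coefficient of the resulting vector, so a nonzero polynomial does not kill the vacuum of the
-- algebraic Fock space (`eq_zero_of_lift_field`). To conclude in the Hilbert space, where null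
-- vectors vanish, the `q`-form must be definite and not merely semidefinite
-- (`eq_zero_of_qForm_self`). This comes from a sharper look at the Gram vectors of the kernel `q ^
-- i(τ σ⁻¹)`: some functional is `1` on the vector of the identity and `0` on all others.
-- Surjectivity is the real linearity of `s_q`.
--
-- For the cohomology of a free algebra `A`, currying the last variable identifies cochains of
-- degree `n + 1` in `V` with cochains of degree `n` in `Hom(A, V)` under a twisted right action
-- (`d_curryRight`), so degree `2` suffices. The unit does not act as the identity in this twisted
-- action in general, even when it does on `V`, so the induction needs nonunital bimodules. In
-- degree `2`, a cocycle is first normalized to vanish when an argument is `1`. It then describes an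
-- extension of the left module `A` by `V`; freeness allows the action of the generators to be
-- prescribed at will, and following the orbit of `(1, 0)` yields a primitive
-- (`exists_eq_of_normalized`).

universe u v w

/-! ### Hochschild cochains: change of algebra and dimension shifting -/

namespace Hochschild

variable {k A B V : Type*} [CommRing k] [Ring A] [Algebra k A] [Ring B] [Algebra k B]
  [AddCommGroup V] [Module k V]

namespace Bimodule

variable (M : Bimodule k A V)

theorem d_apply (n : ℕ) (f : MultilinearMap k (fun _ : Fin n => A) V) (a : Fin (n + 1) → A) :
    M.d n f a = M.left (a 0) (f (Fin.tail a)) +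
      ∑ j : Fin n, (-1 : k) ^ ((j : ℕ) + 1) • f (Fin.contractNth j.castSucc (· * ·) a) +
      (-1 : k) ^ (n + 1) • M.right (MulOpposite.op (a (Fin.last n))) (f (Fin.init a)) := by
  simp [d, outerLeft, outerRight, contract]

theorem subsingleton_cohomology_succ_iff {n : ℕ} :
    Subsingleton (M.cohomology (n + 1)) ↔ ∀ f, M.d (n + 1) f = 0 → ∃ g, M.d n g = f := by
  rw [Submodule.Quotient.subsingleton_iff, Submodule.submoduleOf, Submodule.comap_subtype_eq_top]
  exact Iff.rfl

/-- The restriction of a bimodule along an algebra homomorphism. -/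
def comap (M : Bimodule k B V) (φ : A →ₐ[k] B) : Bimodule k A V where
  left :=
    { toFun a := M.left (φ a)
      map_smul' c a := by simp
      map_zero' := by simp
      map_add' a b := by simp
      map_mul' a b := by simp }
  right :=
    { toFun a := M.right (MulOpposite.op (φ a.unop))
      map_smul' c a := by simp
      map_zero' := by simp
      map_add' a b := by simp
      map_mul' a b := by simp }
  comm a b v := M.comm _ _ v

theorem d_comap (M : Bimodule k B V) (φ : A →ₐ[k] B) (n : ℕ)
    (f : MultilinearMap k (fun _ : Fin n => B) V) :
    (M.comap φ).d n (f.compLinearMap fun _ => φ.toLinearMap) =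
      (M.d n f).compLinearMap fun _ => φ.toLinearMap := by
  ext a
  simp only [d_apply, MultilinearMap.compLinearMap_apply]
  have h (j : Fin n) : (fun i => φ.toLinearMap (Fin.contractNth j.castSucc (· * ·) a i)) =
      Fin.contractNth j.castSucc (· * ·) (fun i => φ.toLinearMap (a i)) := by
    funext i
    simp only [Fin.contractNth]
    split_ifs <;> simp
  simp only [h]
  rfl

/-- The bimodule of linear maps `A → V` with `(a φ)(x) = a φ(x)` and
`(φ a)(x) = φ(a x) - φ(a) x`. -/
def hom : Bimodule k A (A →ₗ[k] V) where
  left :=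
    { toFun a := LinearMap.compRight k (M.left a)
      map_smul' c a := by ext; simp
      map_zero' := by ext; simp
      map_add' a b := by ext; simp
      map_mul' a b := by ext; simp }
  right :=
    { toFun a :=
        { toFun φ :=
            { toFun x := φ (a.unop * x) - M.right (MulOpposite.op x) (φ a.unop)
              map_add' x y := by simp [mul_add]; abel
              map_smul' c x := by simp [smul_sub] }
          map_add' φ ψ := by ext; simp; abel
          map_smul' c φ := by ext; simp [smul_sub] }
      map_smul' c a := by ext; simp [smul_sub]
      map_zero' := by ext; simp
      map_add' a b := by ext; simp [add_mul]; abel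
      -- Associativity: in `((φ a) b)(x)` the two terms `φ(a) b x` cancel, which leaves `φ(a b x) -
      -- φ(a b) x`.
      map_mul' a b := by ext; simp [mul_assoc] }
  comm a b φ := by
    ext x
    simp [M.comm]

theorem hom_left_apply (a : A) (φ : A →ₗ[k] V) (x : A) : M.hom.left a φ x = M.left a (φ x) := rfl

theorem hom_right_apply (a : A) (φ : A →ₗ[k] V) (x : A) :
    M.hom.right (MulOpposite.op a) φ x = φ (a * x) - M.right (MulOpposite.op x) (φ a) := rfl

theorem contractNth_snoc_castSucc {n : ℕ} (j : Fin n) (a : Fin (n + 1) → A) (x : A) :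
    Fin.contractNth j.castSucc.castSucc (· * ·) (Fin.snoc a x : Fin (n + 2) → A) =
      Fin.snoc (Fin.contractNth j.castSucc (· * ·) a) x := by
  funext i
  cases i using Fin.lastCases with
  | last =>
    simp only [Fin.contractNth, Fin.snoc_last, Fin.val_castSucc, Fin.val_last]
    rw [if_neg (by omega), if_neg (by omega), Fin.succ_last, Fin.snoc_last]
  | cast i =>
    simp only [Fin.contractNth, Fin.snoc_castSucc, Fin.val_castSucc, Fin.succ_castSucc]

theorem contractNth_snoc_last {n : ℕ} (a : Fin (n + 1) → A) (x : A) :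
    Fin.contractNth (Fin.last n).castSucc (· * ·) (Fin.snoc a x : Fin (n + 2) → A) =
      Fin.snoc (Fin.init a) (a (Fin.last n) * x) := by
  funext i
  cases i using Fin.lastCases with
  | last =>
    simp [Fin.contractNth]
  | cast i =>
    simp [Fin.contractNth, Fin.init]

/-- The twisted right action on `Hom(A, V)` packs the last two terms of the bar differential into
one: `φ(a x)` is the last inner contraction and `-φ(a) x` the outer right term. Hence currying
commutes with the differentials. -/
theorem d_curryRight (n : ℕ) (f : MultilinearMap k (fun _ : Fin (n + 1) => A) V) :
    M.hom.d n f.curryRight = (M.d (n + 1) f).curryRight := by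
  ext a x
  rw [d_apply, MultilinearMap.curryRight_apply, d_apply, Fin.sum_univ_castSucc]
  simp only [LinearMap.add_apply, LinearMap.sum_apply, LinearMap.smul_apply, hom_left_apply,
    hom_right_apply, MultilinearMap.curryRight_apply, contractNth_snoc_castSucc,
    contractNth_snoc_last, Fin.init_snoc, Fin.snoc_last, Fin.val_castSucc, Fin.val_last]
  have h0 : (Fin.snoc a x : Fin (n + 2) → A) 0 = a 0 := Fin.snoc_castSucc (i := 0) ..
  have ht : Fin.tail (Fin.snoc a x : Fin (n + 2) → A) = Fin.snoc (Fin.tail a) x := by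
    funext i
    cases i using Fin.lastCases with
    | last => simp [Fin.tail]
    | cast i => simp only [Fin.tail, Fin.succ_castSucc, Fin.snoc_castSucc]
  have hi : Fin.snoc (Fin.init a) (a (Fin.last n)) = a := Fin.snoc_init_self a
  rw [h0, ht]
  erw [hi]
  -- The minus sign in the twisted action turns the sign `(-1)^(n+1)` of its outer term into the
  -- required `(-1)^(n+2)`.
  rw [smul_sub, pow_succ _ (n + 1), mul_neg_one, neg_smul]
  abel

/-- Dimension shift: a primitive of the curried cocycle, uncurried, is a primitive of the cocycle.
-/
theorem exists_d_eq_of_hom {n : ℕ}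
    (h : ∀ f, M.hom.d (n + 1) f = 0 → ∃ g, M.hom.d n g = f)
    (f : MultilinearMap k (fun _ : Fin (n + 2) => A) V) (hf : M.d (n + 2) f = 0) :
    ∃ g, M.d (n + 1) g = f := by
  obtain ⟨g, hg⟩ := h f.curryRight (by rw [d_curryRight, hf]; rfl)
  refine ⟨MultilinearMap.uncurryRight g, ?_⟩
  have := M.d_curryRight n (MultilinearMap.uncurryRight g)
  rw [MultilinearMap.curry_uncurryRight, hg] at this
  rw [← MultilinearMap.uncurry_curryRight f, this, MultilinearMap.uncurry_curryRight]

/-! ### Two-cocycles on a free algebra are coboundaries -/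

section TwoCocycle

/-- The `2`-cocycle condition for a bilinear map. -/
def IsTwoCocycle (f : A →ₗ[k] A →ₗ[k] V) : Prop :=
  ∀ a b c, M.left a (f b c) - f (a * b) c + f a (b * c) - M.right (MulOpposite.op c) (f a b) = 0

/-- The coboundary of a linear map as a bilinear map. -/
def twoCoboundary (g : A →ₗ[k] V) : A →ₗ[k] A →ₗ[k] V :=
  LinearMap.mk₂ k
    (fun a b => M.left a (g b) - g (a * b) + M.right (MulOpposite.op b) (g a))
    (fun a a' b => by simp [add_mul]; abel) (fun c a b => by simp [smul_sub, smul_add])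
    (fun a b b' => by simp [mul_add]; abel) (fun c a b => by simp [smul_sub, smul_add])

theorem twoCoboundary_apply (g : A →ₗ[k] V) (a b : A) : M.twoCoboundary g a b =
    M.left a (g b) - g (a * b) + M.right (MulOpposite.op b) (g a) := rfl

theorem left_left (a b : A) (v : V) : M.left a (M.left b v) = M.left (a * b) v := by simp

theorem right_right (a b : A) (v : V) : M.right (MulOpposite.op a) (M.right (MulOpposite.op b) v) =
    M.right (MulOpposite.op (b * a)) v := by simp

variable {M}

theorem IsTwoCocycle.sub {f : A →ₗ[k] A →ₗ[k] V} (hf : M.IsTwoCocycle f) (g : A →ₗ[k] V) :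
    M.IsTwoCocycle (f - M.twoCoboundary g) := by
  intro a b c
  have := hf a b c
  simp only [LinearMap.sub_apply, twoCoboundary_apply, map_sub, map_add, left_left, right_right,
    M.comm, mul_assoc]
  rw [← sub_eq_zero.1 this]
  abel

/-- Every `2`-cocycle is cohomologous to one that vanishes at `(1, 1)`. -/
theorem IsTwoCocycle.exists_apply_one_one {f : A →ₗ[k] A →ₗ[k] V} (hf : M.IsTwoCocycle f) :
    ∃ g, (f - M.twoCoboundary g) 1 1 = 0 := by
  have h := hf 1 1 1
  simp only [mul_one] at h
  -- Put `e = f(1, 1)`. The cocycle identity at `(1, 1, 1)` says `1 e = e 1`, and both actions of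
  -- `1` are idempotent. So `g(1) = 2 (1 e) - e` satisfies `1 g(1) = g(1) 1 = 1 e`, and the
  -- coboundary at `(1, 1)` is `1 e - g(1) + 1 e = e`.
  refine ⟨M.left 1 ∘ₗ f 1 + M.left 1 ∘ₗ f 1 - f 1, ?_⟩
  have h' : M.right (MulOpposite.op 1) (f 1 1) = M.left 1 (f 1 1) := by
    rw [sub_add_cancel] at h; exact (sub_eq_zero.1 h).symm
  simp only [LinearMap.sub_apply, twoCoboundary_apply, LinearMap.add_apply, LinearMap.comp_apply,
    map_sub, map_add, left_left, mul_one, ← M.comm, h']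
  abel

/-- A `2`-cocycle that vanishes at `(1, 1)` is cohomologous to a normalized one. -/
theorem IsTwoCocycle.exists_normalized {f : A →ₗ[k] A →ₗ[k] V} (hf : M.IsTwoCocycle f)
    (h1 : f 1 1 = 0) :
    ∃ g, ∀ c, (f - M.twoCoboundary g) 1 c = 0 ∧ (f - M.twoCoboundary g) c 1 = 0 := by
  -- The witness is `g(c) = -(f(c, 1) + f(1, c) 1)`, with `g(1) = 0`. The identities `hr` and `hp`
  -- say `1 f(1, c) = 0` and `f(c, 1) 1 = 0`; `hm` compares `f(1, c)` with `f(c, 1)`.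
  refine ⟨-(f.flip 1 + M.right (MulOpposite.op 1) ∘ₗ f 1), fun c => ?_⟩
  have hr := hf 1 1 c
  have hp := hf c 1 1
  have hm := hf 1 c 1
  simp only [mul_one, one_mul, h1, map_zero, sub_zero, zero_sub, sub_add_cancel,
    neg_add_cancel, neg_eq_zero] at hr hp hm
  have hm' : f 1 c = M.right (MulOpposite.op 1) (f 1 c) - M.left 1 (f c 1) + f c 1 := by
    rw [← sub_eq_zero, ← hm]; abel
  constructor
  · simp only [LinearMap.sub_apply, twoCoboundary_apply, LinearMap.neg_apply, LinearMap.add_apply,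
      LinearMap.flip_apply, LinearMap.comp_apply, map_neg, map_add, h1, map_zero, M.comm, hr,
      one_mul, neg_zero, add_zero]
    nth_rw 1 [hm']
    abel
  · simp only [LinearMap.sub_apply, twoCoboundary_apply, LinearMap.neg_apply, LinearMap.add_apply,
      LinearMap.flip_apply, LinearMap.comp_apply, map_neg, map_add, h1, map_zero, hp, right_right,
      mul_one, neg_zero, zero_add]
    abel

/-- A normalized `2`-cocycle on a free algebra is a coboundary. -/
theorem IsTwoCocycle.exists_eq_of_normalized {X : Type*} {M : Bimodule k (FreeAlgebra k X) V}
    {f : FreeAlgebra k X →ₗ[k] FreeAlgebra k X →ₗ[k] V} (hf : M.IsTwoCocycle f)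
    (h1 : ∀ c, f 1 c = 0 ∧ f c 1 = 0) : ∃ g, f - M.twoCoboundary g = 0 := by
  -- The extension of `A` by `V` defined by `f`, with action `a (p, v) = (a p, a v - f(a, p))`. It
  -- is imposed on the generators only; freeness extends it to all of `A`.
  let ρ : FreeAlgebra k X →ₐ[k] Module.End k (FreeAlgebra k X × V) :=
    FreeAlgebra.lift k fun i => LinearMap.prod
      (LinearMap.mulLeft k (FreeAlgebra.ι k i) ∘ₗ LinearMap.fst k _ _)
      (M.left (FreeAlgebra.ι k i) ∘ₗ LinearMap.snd k _ _ -
        f (FreeAlgebra.ι k i) ∘ₗ LinearMap.fst k _ _)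
  have hρι (i : X) (p : FreeAlgebra k X × V) : ρ (FreeAlgebra.ι k i) p =
      (FreeAlgebra.ι k i * p.1, M.left (FreeAlgebra.ι k i) p.2 - f (FreeAlgebra.ι k i) p.1) := by
    simp [ρ]
  have hρ1 (a : FreeAlgebra k X) : ∀ p, (ρ a p).1 = a * p.1 := by
    induction a with
    | grade0 r => intro p; simp [Algebra.smul_def]
    | grade1 i => intro p; rw [hρι]
    | mul a b ha hb => intro p; rw [map_mul, Module.End.mul_apply, ha, hb, mul_assoc]
    | add a b ha hb => intro p; rw [map_add, LinearMap.add_apply, Prod.fst_add, ha, hb, add_mul]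
  -- The `V`-component of the orbit of `(1, 0)`. The recursion `hgι` makes `f` and the coboundary of
  -- `g` agree whenever the first argument is a generator.
  let g : FreeAlgebra k X →ₗ[k] V :=
    LinearMap.snd k _ _ ∘ₗ LinearMap.applyₗ ((1, 0) : FreeAlgebra k X × V) ∘ₗ ρ.toLinearMap
  have hg1 : g 1 = 0 := by simp [g]
  have hgι (i : X) (a : FreeAlgebra k X) : g (FreeAlgebra.ι k i * a) =
      M.left (FreeAlgebra.ι k i) (g a) - f (FreeAlgebra.ι k i) a := by
    change (ρ (FreeAlgebra.ι k i * a) (1, 0)).2 = _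
    rw [map_mul, Module.End.mul_apply, hρι, hρ1, mul_one]
    rfl
  have hgι' (i : X) : g (FreeAlgebra.ι k i) = 0 := by
    rw [← mul_one (FreeAlgebra.ι k i), hgι, hg1, (h1 _).2, map_zero, sub_zero]
  refine ⟨g, ?_⟩
  have hF := hf.sub g
  set F := f - M.twoCoboundary g with hFdef
  have hFι (i : X) (c : FreeAlgebra k X) : F (FreeAlgebra.ι k i) c = 0 := by
    simp [hFdef, twoCoboundary_apply, hgι, hgι']
  -- With the terms `F(x_i, ·)` gone, the cocycle identity says that `F` is left linear over the
  -- generators in its first argument.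
  have hstep (i : X) (b c : FreeAlgebra k X) :
      F (FreeAlgebra.ι k i * b) c = M.left (FreeAlgebra.ι k i) (F b c) := by
    have := hF (FreeAlgebra.ι k i) b c
    rw [hFι, hFι, map_zero, sub_zero, add_zero] at this
    exact (sub_eq_zero.1 this).symm
  -- Induction on words, which grow by one generator on the left.
  have key (P : FreeAlgebra k X → Prop) (p1 : P 1) (psmul : ∀ (c : k) a, P a → P (c • a))
      (padd : ∀ a b, P a → P b → P (a + b)) (pι : ∀ i a, P a → P (FreeAlgebra.ι k i * a))
      (a : FreeAlgebra k X) : P a := by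
    have h (a : FreeAlgebra k X) : ∀ b, P b → P (a * b) := by
      induction a with
      | grade0 r => intro b hb; rw [← Algebra.smul_def]; exact psmul r b hb
      | grade1 i => exact pι i
      | mul a a' ha ha' => intro b hb; rw [mul_assoc]; exact ha _ (ha' _ hb)
      | add a a' ha ha' => intro b hb; rw [add_mul]; exact padd _ _ (ha _ hb) (ha' _ hb)
    simpa using h a 1 p1
  -- The unit need not fix `V`, but it fixes the values of `g`: it fixes `x_i g(a)`, and it fixes
  -- `f(x_i, a)` by the cocycle identity at `(1, x_i, a)` for the normalized `f`. This gives `F(1,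
  -- c) = 0`, the start of the final induction.
  have hgone (a : FreeAlgebra k X) : M.left 1 (g a) = g a := by
    refine key (fun a => M.left 1 (g a) = g a) (by simp [hg1]) (fun c a h => by simp [h])
      (fun a b ha hb => by simp [ha, hb]) (fun i a _ => ?_) a
    have := hf 1 (FreeAlgebra.ι k i) a
    rw [(h1 _).1, (h1 _).1, map_zero, sub_zero, add_zero, one_mul] at this
    rw [hgι, map_sub, left_left, one_mul, sub_eq_zero.1 this]
  have hF1 (c : FreeAlgebra k X) : F 1 c = 0 := by
    simp [hFdef, twoCoboundary_apply, (h1 c).1, hg1, hgone]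
  refine LinearMap.ext fun a => ?_
  refine key (fun a => F a = 0) (LinearMap.ext hF1) (fun c a h => by simp [h])
      (fun a b ha hb => by simp [ha, hb]) (fun i a h => LinearMap.ext fun c => ?_) a
  rw [hstep, h]; simp

theorem IsTwoCocycle.exists_eq {X : Type*} {M : Bimodule k (FreeAlgebra k X) V}
    {f : FreeAlgebra k X →ₗ[k] FreeAlgebra k X →ₗ[k] V} (hf : M.IsTwoCocycle f) :
    ∃ g, f = M.twoCoboundary g := by
  obtain ⟨g₁, h₁⟩ := hf.exists_apply_one_one
  obtain ⟨g₂, h₂⟩ := (hf.sub g₁).exists_normalized h₁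
  obtain ⟨g₃, h₃⟩ := ((hf.sub g₁).sub g₂).exists_eq_of_normalized h₂
  refine ⟨g₁ + g₂ + g₃, ?_⟩
  have hadd (g g' : FreeAlgebra k X →ₗ[k] V) :
      M.twoCoboundary (g + g') = M.twoCoboundary g + M.twoCoboundary g' := by
    ext a b
    simp only [twoCoboundary_apply, LinearMap.add_apply, map_add]
    abel
  rw [hadd, hadd, ← sub_eq_zero, ← h₃]
  abel

end TwoCocycle

theorem exists_d_eq_two {X : Type*} (M : Bimodule k (FreeAlgebra k X) V)
    (f : MultilinearMap k (fun _ : Fin 2 => FreeAlgebra k X) V) (hf : M.d 2 f = 0) :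
    ∃ g, M.d 1 g = f := by
  let f' : FreeAlgebra k X →ₗ[k] FreeAlgebra k X →ₗ[k] V :=
    LinearMap.mk₂ k (fun a b => f ![a, b])
      (fun a a' b => by simpa using f.cons_add ![b] a a')
      (fun c a b => by simpa using f.cons_smul ![b] c a)
      (fun a b b' => by
        have h x : Function.update ![a, 0] 1 x = ![a, x] := by ext i; fin_cases i <;> simp
        simpa only [h] using f.map_update_add ![a, 0] 1 b b')
      (fun c a b => by
        have h x : Function.update ![a, 0] 1 x = ![a, x] := by ext i; fin_cases i <;> simp
        simpa only [h] using f.map_update_smul ![a, 0] 1 c b)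
  have hf' : M.IsTwoCocycle f' := by
    intro a b c
    have h := congrArg (fun F => F ![a, b, c]) hf
    have e0 : Fin.contractNth (Fin.castSucc 0) (· * ·) ![a, b, c] = ![a * b, c] := by
      ext i; fin_cases i <;> rfl
    have e1 : Fin.contractNth (Fin.castSucc 1) (· * ·) ![a, b, c] = ![a, b * c] := by
      ext i; fin_cases i <;> rfl
    have e2 : Fin.init ![a, b, c] = ![a, b] := by
      ext i; fin_cases i <;> rfl
    have e3 : ![a, b, c] (Fin.last 2) = c := rfl
    simp only [d_apply, Fin.sum_univ_two, e0, e1, e2, e3] at h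
    have e4 : (-1 : k) ^ (2 + 1) = -1 := by ring
    have e5 (x y : FreeAlgebra k X) : f' x y = f ![x, y] := rfl
    simpa [Fin.tail, sub_eq_add_neg, add_assoc, e4, e5] using h
  obtain ⟨g, hg⟩ := hf'.exists_eq
  refine ⟨g.compMultilinearMap (MultilinearMap.ofSubsingleton k _ _ (0 : Fin 1) LinearMap.id), ?_⟩
  ext a
  have h : f' (a 0) (a 1) = _ := congrArg (fun F => F (a 0) (a 1)) hg
  have ha : f' (a 0) (a 1) = f a := congrArg f (by ext i; fin_cases i <;> rfl)
  rw [← ha, h, twoCoboundary_apply, d_apply]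
  simp [Fin.tail, Fin.init, Fin.contractNth, sub_eq_add_neg]

/-- The induction runs over all bimodules at once, since each step replaces `V` by `Hom(A, V)`. The
universe `max u v w` is closed under this passage. -/
theorem exists_d_eq_freeAlgebra {k : Type u} {X : Type v} [CommRing k] (n : ℕ) :
    ∀ {V : Type (max u v w)} [AddCommGroup V] [Module k V] (M : Bimodule k (FreeAlgebra k X) V)
    (f : MultilinearMap k (fun _ : Fin (n + 2) => FreeAlgebra k X) V),
    M.d (n + 2) f = 0 → ∃ g, M.d (n + 1) g = f := by
  induction n with
  | zero => exact fun M f hf => M.exists_d_eq_two f hf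
  | succ n ih => exact fun M => M.exists_d_eq_of_hom (ih M.hom)

/-- Free algebras have no Hochschild cohomology in degree `2` and above. -/
theorem exists_d_eq_of_algEquiv {k : Type u} {X : Type v} [CommRing k] {A : Type*} [Ring A]
    [Algebra k A] {V : Type (max u v w)} [AddCommGroup V] [Module k V] (e : FreeAlgebra k X ≃ₐ[k] A)
    (M : Bimodule k A V) (n : ℕ) (f : MultilinearMap k (fun _ : Fin (n + 2) => A) V)
    (hf : M.d (n + 2) f = 0) : ∃ g, M.d (n + 1) g = f := by
  obtain ⟨g, hg⟩ := exists_d_eq_freeAlgebra n (M.comap e.toAlgHom)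
    (f.compLinearMap fun _ => e.toAlgHom.toLinearMap) (by rw [d_comap, hf]; rfl)
  have h : g = (g.compLinearMap fun _ => e.symm.toAlgHom.toLinearMap).compLinearMap
      fun _ => e.toAlgHom.toLinearMap := by
    ext a; simp
  refine ⟨g.compLinearMap fun _ => e.symm.toAlgHom.toLinearMap, ?_⟩
  rw [h, d_comap] at hg
  ext a
  simpa using congrArg (fun F => F fun i => e.symm (a i)) hg

end Bimodule
end Hochschild

/-! ### Noncommutative polynomials: evaluation and expansion in monomials -/

namespace NCPoly

variable {κ : Type*}

@[elab_as_elim]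
theorem ind {P : NCPoly κ → Prop} (p : NCPoly κ) (algebraMap : ∀ r, P (algebraMap ℂ (NCPoly κ) r))
    (X : ∀ i, P (X i)) (mul : ∀ a b, P a → P b → P (a * b)) (add : ∀ a b, P a → P b → P (a + b)) :
    P p :=
  FreeAlgebra.induction ℂ κ algebraMap X mul add p

/-- The algebra homomorphism that sends `X i` to `f i`. -/
noncomputable def lift {A : Type*} [Ring A] [Algebra ℂ A] (f : κ → A) : NCPoly κ →ₐ[ℂ] A :=
  FreeAlgebra.lift ℂ f

theorem lift_X {A : Type*} [Ring A] [Algebra ℂ A] (f : κ → A) (i : κ) : lift f (X i) = f i :=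
  FreeAlgebra.lift_ι_apply f i

/-- The `*`-algebra homomorphism that sends `X i` to the self-adjoint element `f i`. -/
noncomputable def starLift {A : Type*} [Ring A] [StarRing A] [Algebra ℂ A] [StarModule ℂ A]
    (f : κ → A) (hf : ∀ i, star (f i) = f i) : NCPoly κ →⋆ₐ[ℂ] A where
  __ := lift f
  map_star' p := by
    change lift f (star p) = star (lift f p)
    induction p using ind with
    | algebraMap r => rw [← algebraMap_star_comm, AlgHom.commutes, AlgHom.commutes,
        algebraMap_star_comm]
    | X i => rw [star_X, lift_X, hf]
    | mul a b ha hb => rw [star_mul, map_mul, map_mul, star_mul, ha, hb]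
    | add a b ha hb => rw [star_add, map_add, map_add, star_add, ha, hb]

theorem starLift_X {A : Type*} [Ring A] [StarRing A] [Algebra ℂ A] [StarModule ℂ A]
    (f : κ → A) (hf : ∀ i, star (f i) = f i) (i : κ) : starLift f hf (X i) = f i :=
  lift_X f i

/-- The noncommutative monomial of a word. -/
noncomputable def monomial (w : List κ) : NCPoly κ := (w.map X).prod

theorem exists_eq_sum_monomial (p : NCPoly κ) :
    ∃ c : List κ →₀ ℂ, p = c.sum fun w z => z • monomial w := by
  suffices h : p ∈ Submodule.span ℂ (Set.range (monomial (κ := κ))) by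
    obtain ⟨c, hc⟩ := (Finsupp.mem_span_range_iff_exists_finsupp).1 h
    exact ⟨c, hc.symm⟩
  induction p using ind with
  | algebraMap r =>
    rw [Algebra.algebraMap_eq_smul_one]
    exact Submodule.smul_mem _ _ (Submodule.subset_span ⟨[], rfl⟩)
  | X i => exact Submodule.subset_span ⟨[i], by simp [monomial]⟩
  | mul a b ha hb =>
    have := Submodule.mul_mem_mul ha hb
    rw [Submodule.span_mul_span] at this
    refine Submodule.span_mono ?_ this
    rintro _ ⟨_, ⟨v, rfl⟩, _, ⟨w, rfl⟩, rfl⟩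
    exact ⟨v ++ w, by simp [monomial]⟩
  | add a b ha hb => exact add_mem ha hb

end NCPoly

namespace QGaussian

/-! ### Strict positivity of the `q`-deformed inner product -/

section Positivity

theorem eq_one_of_forall_lt {n : ℕ} {σ : Equiv.Perm (Fin n)}
    (h : ∀ p : Fin n × Fin n, p.1 < p.2 → ¬ σ p.2 < σ p.1) : σ = 1 := by
  have hm : StrictMono σ := fun a b hab =>
    lt_of_le_of_ne (not_lt.1 (h (a, b) hab)) fun e => hab.ne (σ.injective e)
  ext i : 1
  have := Subsingleton.elim (hm.orderIsoOfSurjective σ σ.surjective) (OrderIso.refl _)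
  exact congrArg (fun e : Fin n ≃o Fin n => e i) this

/-- The kernel `q ^ i(τ σ⁻¹)` is the Gram matrix of vectors one of which is not in the span of the
others. -/
theorem exists_gram_dual (q : ℝ) (hq : -1 < q) (hq' : q < 1) (n : ℕ) :
    ∃ (v : (Fin n × Fin n → Bool) → Equiv.Perm (Fin n) → ℝ) (c : (Fin n × Fin n → Bool) → ℝ),
      (∀ σ τ, q ^ inversions (τ * σ⁻¹) = ∑ k, v k σ * v k τ) ∧
      ∀ σ, ∑ k, c k * v k σ = if σ = 1 then 1 else 0 := by
  have hs : 0 < 1 - q ^ 2 := by nlinarith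
  have hs' : √(1 - q ^ 2) ≠ 0 := (Real.sqrt_pos.2 hs).ne'
  have hss := Real.mul_self_sqrt hs.le
  -- Each pair `a < b` contributes a unit vector of the plane: `(1, 0)` if `σ` keeps the order and
  -- `(q, √(1 - q²))` if it inverts it. Two such vectors have inner product `1` or `q`, so the
  -- tensor products over all pairs have the kernel as Gram matrix.
  let w (p : Fin n × Fin n) (b : Bool) (σ : Equiv.Perm (Fin n)) : ℝ :=
    if p.1 < p.2 then
      (if σ p.2 < σ p.1 then (if b then √(1 - q ^ 2) else q) else (if b then 0 else 1))
    else (if b then 0 else 1)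
  -- This plane vector has inner product `1` with `(1, 0)` and `0` with `(q, √(1 - q²))`. Its tensor
  -- power thus annihilates the vector of every `σ` with an inversion; here `|q| < 1` is needed.
  let d (b : Bool) : ℝ := if b then -q / √(1 - q ^ 2) else 1
  refine ⟨fun k σ => ∏ p, w p (k p) σ, fun k => ∏ p, d (k p), fun σ τ => ?_, fun σ => ?_⟩
  · simp_rw [← Finset.prod_mul_distrib]
    rw [pow_inv_eq_prod, ← Fintype.prod_sum (fun p b => w p b σ * w p b τ)]
    refine Finset.prod_congr rfl fun p _ => ?_
    simp only [w, Fintype.sum_bool]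
    by_cases h1 : p.1 < p.2 <;> by_cases h2 : σ p.2 < σ p.1 <;> by_cases h3 : τ p.2 < τ p.1 <;>
      simp [h1, h2, h3, hss]
    ring
  · simp_rw [← Finset.prod_mul_distrib]
    rw [← Fintype.prod_sum (fun p b => d b * w p b σ)]
    have h (p : Fin n × Fin n) : ∑ b, d b * w p b σ =
        if p.1 < p.2 ∧ σ p.2 < σ p.1 then 0 else 1 := by
      simp only [w, d, Fintype.sum_bool]
      by_cases h1 : p.1 < p.2 <;> by_cases h2 : σ p.2 < σ p.1 <;> simp [h1, h2]
      field_simp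
      ring
    simp_rw [h]
    split_ifs with h1
    · subst h1
      exact Finset.prod_eq_one fun p _ => if_neg fun h => h.1.not_gt h.2
    · by_contra h2
      refine h1 (eq_one_of_forall_lt fun p hp hσ => h2 ?_)
      exact Finset.prod_eq_zero (Finset.mem_univ p) (if_pos ⟨hp, hσ⟩)

variable {H : Type*} [NormedAddCommGroup H] [InnerProductSpace ℂ H] [FiniteDimensional ℂ H]

theorem eq_zero_of_tensorInner_self {n : ℕ} {x : ⨂[ℂ]^n H} (hx : (tensorInner n x x).re = 0) :
    x = 0 := by
  rw [tensorInner_apply, Complex.re_sum] at hx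
  have h (p) : (conj ((tensorBasis H n).repr x p) * (tensorBasis H n).repr x p).re =
      Complex.normSq ((tensorBasis H n).repr x p) := by
    rw [mul_comm, Complex.mul_conj, Complex.ofReal_re]
  simp_rw [h] at hx
  rw [Finset.sum_eq_zero_iff_of_nonneg fun p _ => Complex.normSq_nonneg _] at hx
  refine (tensorBasis H n).ext_elem fun p => ?_
  simpa using hx p (Finset.mem_univ p)

/-- Permutations of the factors preserve the undeformed inner product, so averaging over a
simultaneous permutation of both arguments brings in the kernel `q ^ i(τ σ⁻¹)`. Its Gram
factorization gives a sum of squares. -/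
theorem factorial_mul_qForm_self {q : ℝ} {n : ℕ}
    {v : (Fin n × Fin n → Bool) → Equiv.Perm (Fin n) → ℝ}
    (hv : ∀ σ τ, q ^ inversions (τ * σ⁻¹) = ∑ k, v k σ * v k τ) (x : ⨂[ℂ]^n H) :
    (n.factorial : ℂ) * qForm q n x x = ∑ k, tensorInner n
      (∑ τ, (v k τ : ℂ) • permute τ x) (∑ σ, (v k σ : ℂ) • permute σ x) := by
  have h1 (σ : Equiv.Perm (Fin n)) : qForm q n x x =
      ∑ τ, ((∑ k, v k σ * v k τ : ℝ) : ℂ) * tensorInner n (permute τ x) (permute σ x) := by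
    rw [qForm_eq_sum, ← Equiv.sum_comp (Equiv.mulRight σ⁻¹)]
    refine Finset.sum_congr rfl fun τ _ => ?_
    rw [Equiv.coe_mulRight, ← hv σ τ, Complex.ofReal_pow, ← tensorInner_permute σ,
      ← permute_mul, inv_mul_cancel_right]
  calc (n.factorial : ℂ) * qForm q n x x
      = ∑ _σ : Equiv.Perm (Fin n), qForm q n x x := by
        simp [Fintype.card_perm]
    _ = _ := by
        rw [Finset.sum_congr rfl fun σ _ => h1 σ]
        simp only [map_sum, LinearMap.sum_apply, map_smulₛₗ, LinearMap.smul_apply, smul_eq_mul,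
          Complex.ofReal_sum, Complex.ofReal_mul, Finset.sum_mul, Complex.conj_ofReal,
          RingHom.id_apply]
        simp only [Finset.mul_sum]
        conv_rhs => rw [Finset.sum_comm]
        refine Finset.sum_congr rfl fun σ _ => ?_
        rw [Finset.sum_comm]
        simp only [mul_assoc]

/-- The `q`-deformed inner product is positive definite. -/
theorem eq_zero_of_qForm_self {q : ℝ} (hq : -1 < q) (hq' : q < 1) {n : ℕ} {x : ⨂[ℂ]^n H}
    (hx : (qForm q n x x).re = 0) : x = 0 := by
  obtain ⟨v, c, hv, hc⟩ := exists_gram_dual q hq hq' n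
  have h2 := congrArg Complex.re (factorial_mul_qForm_self hv x)
  rw [← Complex.ofReal_natCast, Complex.re_ofReal_mul, Complex.re_sum, hx, mul_zero, eq_comm,
    Finset.sum_eq_zero_iff_of_nonneg fun p _ => tensorInner_self_nonneg _] at h2
  have h3 (k) : ∑ τ, (v k τ : ℂ) • permute τ x = 0 :=
    eq_zero_of_tensorInner_self (h2 k (Finset.mem_univ k))
  -- Every square vanishes; combining these equations with the dual vector `c` isolates the term `τ
  -- = 1`, which is `x`.
  have h4 : ∑ τ, ((∑ k, c k * v k τ : ℝ) : ℂ) • permute τ x = 0 := by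
    simp only [Complex.ofReal_sum, Complex.ofReal_mul, Finset.sum_smul, mul_smul]
    rw [Finset.sum_comm]
    refine Finset.sum_eq_zero fun k _ => ?_
    rw [← Finset.smul_sum, h3, smul_zero]
  simp only [hc] at h4
  have h5 := permute_inv_cancel (1 : Equiv.Perm (Fin n)) x
  rw [inv_one, ← permute_mul, one_mul] at h5
  simpa [h5] using h4

end Positivity

/-! ### The algebraic Fock space: leading terms of words on the vacuum -/

namespace AlgFock

variable {q : Set.Ioo (-1 : ℝ) 1} {H : Type*} [NormedAddCommGroup H] [InnerProductSpace ℂ H]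

/-- The left annihilation operator on the algebraic Fock space. -/
noncomputable def annihilate (ξ : H) : AlgFock q H →ₗ[ℂ] AlgFock q H :=
  lift fun n => match n with
    | 0 => 0
    | n + 1 => of q n ∘ₗ annih q ξ n

theorem annihilate_of_zero (ξ : H) (x : ⨂[ℂ]^0 H) : annihilate ξ (of q 0 x) = 0 :=
  lift_of _ _ _

theorem annihilate_of_succ (ξ : H) {n : ℕ} (x : ⨂[ℂ]^(n + 1) H) :
    annihilate ξ (of q (n + 1) x) = of q n (annih q ξ n x) :=
  lift_of _ _ _

/-- The vectors with components in degree less than `n` only. -/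
noncomputable def degreeLT (q : Set.Ioo (-1 : ℝ) 1) (H : Type*) [NormedAddCommGroup H] [InnerProductSpace ℂ H]
    (n : ℕ) : Submodule ℂ (AlgFock q H) :=
  Submodule.span ℂ {y | ∃ k < n, ∃ x : ⨂[ℂ]^k H, y = of q k x}

theorem degreeLT_mono : Monotone (degreeLT q H) := by
  refine fun n m h => Submodule.span_mono ?_
  rintro _ ⟨k, hk, x, rfl⟩
  exact ⟨k, hk.trans_le h, x, rfl⟩

theorem create_mem {ξ : H} {n : ℕ} {y : AlgFock q H} (hy : y ∈ degreeLT q H n) :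
    create ξ y ∈ degreeLT q H (n + 1) := by
  refine Submodule.span_le (p := (degreeLT q H (n + 1)).comap (create ξ)) |>.2 ?_ hy
  rintro _ ⟨k, hk, x, rfl⟩
  exact Submodule.subset_span ⟨k + 1, by omega, _, create_of _ _⟩

theorem annihilate_mem {ξ : H} {n : ℕ} {y : AlgFock q H} (hy : y ∈ degreeLT q H (n + 1)) :
    annihilate ξ y ∈ degreeLT q H n := by
  refine Submodule.span_le (p := (degreeLT q H n).comap (annihilate ξ)) |>.2 ?_ hy
  rintro _ ⟨k, hk, x, rfl⟩
  cases k with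
  | zero => change annihilate ξ _ ∈ degreeLT q H n; rw [annihilate_of_zero]; exact zero_mem _
  | succ k => exact Submodule.subset_span ⟨k, by omega, _, annihilate_of_succ _ _⟩

/-- The undeformed annihilation operator `ξ₀ ⊗ … ⊗ ξₙ ↦ ⟪ξ, ξ₀⟫ ξ₁ ⊗ … ⊗ ξₙ`. -/
noncomputable def freeAnnihilate (ξ : H) : AlgFock q H →ₗ[ℂ] AlgFock q H :=
  lift fun n => match n with
    | 0 => 0
    | n + 1 => of q n ∘ₗ contractLeft ξ n

theorem freeAnnihilate_mem {ξ : H} {n : ℕ} {y : AlgFock q H} (hy : y ∈ degreeLT q H (n + 1)) :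
    freeAnnihilate ξ y ∈ degreeLT q H n := by
  refine Submodule.span_le (p := (degreeLT q H n).comap (freeAnnihilate ξ)) |>.2 ?_ hy
  rintro _ ⟨k, hk, x, rfl⟩
  cases k with
  | zero =>
    change freeAnnihilate ξ _ ∈ degreeLT q H n
    rw [show freeAnnihilate ξ (of q 0 x) = 0 from lift_of _ _ _]
    exact zero_mem _
  | succ k => exact Submodule.subset_span ⟨k, by omega, _, lift_of _ _ _⟩

theorem freeAnnihilate_create (ξ η : H) (y : AlgFock q H) :
    freeAnnihilate ξ (create η y) = inner ℂ ξ η • y := by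
  induction y using ind with
  | zero => simp
  | hof n y =>
    rw [create_of, freeAnnihilate, lift_of, ← map_smul]
    change of q n (contractLeft ξ n (cons η n y)) = _
    congr 1
    induction y using PiTensorProduct.induction_on with
    | smul_tprod r x => simp [cons_tprod, contractLeft_tprod, smul_comm r]
    | add x y hx hy => simp only [map_add, smul_add, hx, hy]
  | add x y hx hy => simp only [map_add, smul_add, hx, hy]

/-- The vacuum vector. -/
noncomputable def vacuum (q : Set.Ioo (-1 : ℝ) 1) (H : Type*) [NormedAddCommGroup H]
    [InnerProductSpace ℂ H] : AlgFock q H :=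
  of q 0 (PiTensorProduct.tprod ℂ Fin.elim0)

/-- The coefficient of `e_{w(1)} ⊗ … ⊗ e_{w(n)}`. -/
noncomputable def coeff {κ : Type*} (e : κ → H) : List κ → AlgFock q H →ₗ[ℂ] ℂ
  -- The empty product identifies `H^{⊗ 0}` with `ℂ`; the zero map is never evaluated, as there are
  -- no factors.
  | [] => (PiTensorProduct.lift (MultilinearMap.mkPiAlgebra ℂ (Fin 0) ℂ |>.compLinearMap
      fun _ => (0 : H →ₗ[ℂ] ℂ))) ∘ₗ component 0
  | i :: w => coeff e w ∘ₗ freeAnnihilate (e i)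

theorem coeff_nil_vacuum {κ : Type*} (e : κ → H) : coeff e [] (vacuum q H) = 1 := by
  simp [coeff, vacuum, component_of_self]

theorem coeff_eq_zero {κ : Type*} (e : κ → H) (w : List κ) {y : AlgFock q H}
    (hy : y ∈ degreeLT q H w.length) : coeff e w y = 0 := by
  induction w generalizing y with
  | nil =>
    have : y = 0 := by simpa [degreeLT] using hy
    simp [this]
  | cons i w ih => exact ih (freeAnnihilate_mem hy)

/-- The sum of creation and annihilation operator on the algebraic Fock space. -/
noncomputable def field (ξ : H) : Module.End ℂ (AlgFock q H) := create ξ + annihilate ξ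

theorem field_mem {ξ : H} {n : ℕ} {y : AlgFock q H} (hy : y ∈ degreeLT q H (n + 1)) :
    field ξ y ∈ degreeLT q H (n + 2) :=
  add_mem (create_mem hy) (degreeLT_mono (by omega) (annihilate_mem hy))

variable {κ : Type*} {e : κ → H}

theorem lift_field_monomial_mem (w : List κ) :
    NCPoly.lift (fun i => field (e i)) (NCPoly.monomial w) (vacuum q H) ∈
      degreeLT q H (w.length + 1) := by
  induction w with
  | nil =>
    have h : vacuum q H ∈ degreeLT q H 1 := Submodule.subset_span ⟨0, Nat.zero_lt_one, _, rfl⟩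
    simpa [NCPoly.monomial] using h
  | cons i w ih =>
    have h : NCPoly.monomial (i :: w) = NCPoly.X i * NCPoly.monomial w := by simp [NCPoly.monomial]
    rw [h, map_mul, NCPoly.lift_X, Module.End.mul_apply]
    exact field_mem ih

/-- Triangularity with respect to length: coefficients at words at least as long as `w` see only the
leading tensor `e_w`. -/
theorem coeff_lift_field_monomial [DecidableEq κ] (he : Orthonormal ℂ e) (v w : List κ)
    (h : w.length ≤ v.length) :
    coeff e v (NCPoly.lift (fun i => field (e i)) (NCPoly.monomial w) (vacuum q H)) =
      if v = w then 1 else 0 := by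
  induction w generalizing v with
  | nil =>
    cases v with
    | nil => simp [NCPoly.monomial, coeff_nil_vacuum]
    | cons i v =>
      rw [coeff_eq_zero, if_neg (by simp)]
      exact degreeLT_mono (by simp) (lift_field_monomial_mem _)
  | cons j w ih =>
    cases v with
    | nil => simp at h
    | cons i v =>
      have hm : NCPoly.monomial (j :: w) = NCPoly.X j * NCPoly.monomial w := by
        simp [NCPoly.monomial]
      rw [hm, map_mul, NCPoly.lift_X, Module.End.mul_apply, field, LinearMap.add_apply, map_add,
        coeff_eq_zero e (i :: v) (y := annihilate _ _), add_zero]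
      · rw [coeff, LinearMap.comp_apply, freeAnnihilate_create, map_smul,
          ih v (by simpa using h), orthonormal_iff_ite.1 he]
        by_cases h1 : i = j <;> by_cases h2 : v = w <;> simp [h1, h2]
      -- Annihilation leaves only degrees below `w.length`, out of reach of a coefficient at the
      -- longer word `i :: v`.
      · exact degreeLT_mono (by simp at h ⊢; omega) (annihilate_mem (lift_field_monomial_mem w))

theorem eq_zero_of_lift_field (he : Orthonormal ℂ e) (p : NCPoly κ)
    (hp : NCPoly.lift (fun i => field (e i)) p (vacuum q H) = 0) : p = 0 := by
  classical
  obtain ⟨c, rfl⟩ := p.exists_eq_sum_monomial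
  by_contra hc
  have hne : c.support.Nonempty := by
    rw [Finsupp.support_nonempty_iff]
    rintro rfl
    exact hc Finsupp.sum_zero_index
  -- At a longest word of the support, no other monomial contributes to the coefficient.
  obtain ⟨v, hv, hmax⟩ := c.support.exists_max_image List.length hne
  have h := congrArg (coeff e v) hp
  rw [Finsupp.sum, map_sum, LinearMap.sum_apply, map_sum, map_zero] at h
  rw [Finset.sum_eq_single v] at h
  · rw [map_smul, LinearMap.smul_apply, map_smul, coeff_lift_field_monomial he v v le_rfl,
      if_pos rfl] at h
    exact Finsupp.mem_support_iff.1 hv (by simpa using h)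
  · intro w hw hwv
    rw [map_smul, LinearMap.smul_apply, map_smul, coeff_lift_field_monomial he v w (hmax w hw),
      if_neg hwv.symm, smul_zero]
  · exact fun h => absurd hv h

variable [FiniteDimensional ℂ H]

theorem inner_create (ξ : H) (x y : AlgFock q H) :
    inner ℂ (create ξ x) y = inner ℂ x (annihilate ξ y) := by
  induction x using ind with
  | zero => simp
  | hof n x =>
    induction y using ind with
    | zero => simp
    | hof m y =>
      rw [create_of]
      cases m with
      | zero => rw [annihilate_of_zero, inner_zero_right, inner_of_of_ne (by omega)]
      | succ m =>
        rw [annihilate_of_succ]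
        by_cases h : n = m
        · subst h
          rw [inner_of_of, inner_of_of, qForm_cons]
        · rw [inner_of_of_ne (by omega), inner_of_of_ne h]
    | add y y' hy hy' => simp only [map_add, inner_add_right, hy, hy']
  | add x x' hx hx' => simp only [map_add, inner_add_left, hx, hx']

/-- Definiteness in each degree and orthogonality of the degrees make the seminorm a norm, so the
algebraic Fock space embeds into its completion. -/
theorem eq_zero_of_norm_eq_zero {x : AlgFock q H} (hx : ‖x‖ = 0) : x = 0 := by
  obtain ⟨N, hN⟩ := exists_eq_sum x
  have h := norm_sum_sq (q := q) N (fun n => n) Function.injective_id (fun n => component n x)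
  rw [← hN, hx, zero_pow two_ne_zero, eq_comm,
    Finset.sum_eq_zero_iff_of_nonneg fun n _ => sq_nonneg _] at h
  rw [hN]
  refine Finset.sum_eq_zero fun n hn => ?_
  have h1 := h n hn
  rw [norm_sq_eq_re_inner (𝕜 := ℂ), inner_of_of] at h1
  rw [eq_zero_of_qForm_self q.2.1 q.2.2 h1, map_zero]

end AlgFock

end QGaussian

namespace QGaussian

/-! ### Creation operators and their adjoints on the Hilbert space -/

section Operators

variable {q : Set.Ioo (-1 : ℝ) 1} {H : Type*} [NormedAddCommGroup H] [InnerProductSpace ℂ H]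
  [FiniteDimensional ℂ H]

theorem star_creation_coe (ξ : H) (y : AlgFock q H) :
    star (creation q ξ) (y : FockSpace q H) = (AlgFock.annihilate ξ y : AlgFock q H) := by
  refine ext_inner_left ℂ fun x => ?_
  rw [ContinuousLinearMap.star_eq_adjoint, ContinuousLinearMap.adjoint_inner_right]
  induction x using UniformSpace.Completion.induction_on with
  | hp => exact isClosed_eq (by fun_prop) (by fun_prop)
  | ih x =>
    rw [creation_coe, UniformSpace.Completion.inner_coe, UniformSpace.Completion.inner_coe,
      AlgFock.inner_create]

omit [FiniteDimensional ℂ H] in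
theorem cons_add (ξ η : H) (n : ℕ) : cons (ξ + η) n = cons ξ n + cons η n := by
  simp only [cons, map_add]

omit [FiniteDimensional ℂ H] in
theorem cons_smul (c : ℂ) (ξ : H) (n : ℕ) : cons (c • ξ) n = c • cons ξ n := by
  simp only [cons, map_smul]

theorem creation_add (ξ η : H) : creation q (ξ + η) = creation q ξ + creation q η := by
  refine ContinuousLinearMap.ext fun x => ?_
  induction x using UniformSpace.Completion.induction_on with
  | hp => exact isClosed_eq (creation q _).continuous (creation q ξ + creation q η).continuous
  | ih x =>
    rw [add_apply, creation_coe, creation_coe, creation_coe, ← UniformSpace.Completion.coe_add]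
    congr 1
    induction x using AlgFock.ind with
    | zero => simp
    | hof n x =>
      rw [AlgFock.create_of, AlgFock.create_of, AlgFock.create_of, ← map_add, cons_add,
        LinearMap.add_apply]
    | add x y hx hy => rw [map_add, map_add, map_add, hx, hy]; abel

theorem creation_smul (c : ℂ) (ξ : H) : creation q (c • ξ) = c • creation q ξ := by
  refine ContinuousLinearMap.ext fun x => ?_
  induction x using UniformSpace.Completion.induction_on with
  | hp => exact isClosed_eq (creation q _).continuous (c • creation q ξ).continuous
  | ih x =>
    change _ = c • creation q ξ (x : FockSpace q H)
    rw [creation_coe, creation_coe, ← UniformSpace.Completion.coe_smul]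
    congr 1
    induction x using AlgFock.ind with
    | zero => simp
    | hof n x =>
      rw [AlgFock.create_of, AlgFock.create_of, ← map_smul, cons_smul, LinearMap.smul_apply]
    | add x y hx hy => rw [map_add, map_add, smul_add, hx, hy]

end Operators

/-! ### Freeness of the `q`-Gaussian algebra -/

section Gaussian

variable {E : Type*} [NormedAddCommGroup E] [InnerProductSpace ℝ E] {q : Set.Ioo (-1 : ℝ) 1}
  {κ : Type*}

theorem Cpx.mk_add (z : ℂ) (x y : E) : Cpx.mk z (x + y) = Cpx.mk z x + Cpx.mk z y :=
  TensorProduct.tmul_add z x y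

theorem Cpx.mk_one_smul (r : ℝ) (x : E) : Cpx.mk 1 (r • x) = (r : ℂ) • Cpx.mk 1 x := by
  rw [Cpx.smul_mk, mul_one]
  refine (TensorProduct.smul_tmul r 1 x).symm.trans ?_
  rw [Complex.real_smul, mul_one]
  rfl

theorem orthonormal_mk_one {b : κ → E} (hb : Orthonormal ℝ b) :
    Orthonormal ℂ fun i => Cpx.mk 1 (b i) := by
  classical
  rw [orthonormal_iff_ite] at hb ⊢
  intro i j
  rw [Cpx.inner_mk, hb]
  split_ifs <;> simp

variable [FiniteDimensional ℝ E]

theorem gaussianVar_add (x y : E) :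
    gaussianVar q (x + y) = gaussianVar q x + gaussianVar q y := by
  simp only [gaussianVar, Cpx.mk_add, creation_add, star_add]
  abel

/-- Only real scalars are allowed, because the adjoint term is conjugate linear. -/
theorem gaussianVar_smul (r : ℝ) (x : E) :
    gaussianVar q (r • x) = (r : ℂ) • gaussianVar q x := by
  simp only [gaussianVar, Cpx.mk_one_smul, creation_smul, star_smul, RCLike.star_def,
    Complex.conj_ofReal, smul_add]

theorem gaussianVar_sum {ι : Type*} (s : Finset ι) (x : ι → E) :
    gaussianVar q (∑ i ∈ s, x i) = ∑ i ∈ s, gaussianVar q (x i) := by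
  classical
  induction s using Finset.induction_on with
  | empty => simpa using gaussianVar_smul (q := q) 0 (0 : E)
  | insert i s hi ih => rw [Finset.sum_insert hi, Finset.sum_insert hi, gaussianVar_add, ih]

theorem gaussianVar_coe (x : E) (y : AlgFock q (Cpx E)) :
    gaussianVar q x (y : FockSpace q (Cpx E)) =
      (AlgFock.field (Cpx.mk 1 x) y : AlgFock q (Cpx E)) := by
  rw [gaussianVar, add_apply, creation_coe, star_creation_coe,
    ← UniformSpace.Completion.coe_add]
  rfl

theorem star_gaussianVar (x : E) : star (gaussianVar q x) = gaussianVar q x := by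
  rw [gaussianVar, star_add, star_star, add_comm]

theorem star_gen (x : E) : star (gen q x) = gen q x :=
  Subtype.ext (star_gaussianVar x)

theorem lift_gen_coe (b : κ → E) (p : NCPoly κ) : ∀ y : AlgFock q (Cpx E),
    (NCPoly.lift (fun i => gen q (b i)) p : FockSpace q (Cpx E) →L[ℂ] FockSpace q (Cpx E))
      (y : FockSpace q (Cpx E)) =
      (NCPoly.lift (fun i => AlgFock.field (Cpx.mk 1 (b i))) p y : AlgFock q (Cpx E)) := by
  induction p using NCPoly.ind with
  | algebraMap r =>
    intro y
    rw [AlgHom.commutes, AlgHom.commutes, Module.algebraMap_end_apply,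
      UniformSpace.Completion.coe_smul]
    rfl
  | X i => intro y; rw [NCPoly.lift_X, NCPoly.lift_X]; exact gaussianVar_coe _ _
  | mul a b ha hb =>
    intro y
    rw [map_mul, map_mul, Module.End.mul_apply, ← ha, ← hb]
    rfl
  | add a b ha hb =>
    intro y
    rw [map_add, map_add, LinearMap.add_apply, UniformSpace.Completion.coe_add, ← ha, ← hb]
    rfl

/-- An operator that vanishes on the Fock space kills the vacuum, which already forces the
polynomial to be zero. -/
theorem lift_gen_injective {b : κ → E} (hb : Orthonormal ℝ b) :
    Function.Injective (NCPoly.lift fun i => gen q (b i)) := by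
  refine (injective_iff_map_eq_zero _).2 fun p hp => ?_
  refine AlgFock.eq_zero_of_lift_field (q := q) (orthonormal_mk_one hb) p ?_
  refine AlgFock.eq_zero_of_norm_eq_zero ?_
  rw [← UniformSpace.Completion.norm_coe, ← lift_gen_coe, hp]
  exact norm_zero

variable (q) in
/-- The evaluation of noncommutative polynomials at `q`-Gaussian variables. -/
noncomputable def evalGen (b : κ → E) : NCPoly κ →⋆ₐ[ℂ] gaussianAlgebra E q :=
  NCPoly.starLift (fun i => gen q (b i)) fun i => star_gen (b i)

theorem evalGen_X (b : κ → E) (i : κ) : evalGen q b (NCPoly.X i) = gen q (b i) :=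
  NCPoly.starLift_X (fun i => gen q (b i)) (fun i => star_gen (b i)) i

theorem evalGen_injective {b : κ → E} (hb : Orthonormal ℝ b) :
    Function.Injective (evalGen q b) :=
  lift_gen_injective hb

theorem evalGen_surjective [Fintype κ] (b : OrthonormalBasis κ ℝ E) :
    Function.Surjective (evalGen q b) := by
  let Ψ := (gaussianAlgebra E q).subtype.comp (evalGen q b)
  have hΨ (i : κ) : Ψ (NCPoly.X i) = gaussianVar q (b i) :=
    congrArg Subtype.val (evalGen_X b i)
  -- The range is a `*`-subalgebra, and by real linearity it contains the variable of every vector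
  -- once it contains those of a basis.
  have h : gaussianAlgebra E q ≤ Ψ.range := by
    refine StarAlgebra.adjoin_le ?_
    rintro _ ⟨x, rfl⟩
    rw [← b.sum_repr x, gaussianVar_sum]
    refine sum_mem fun i _ => ?_
    rw [gaussianVar_smul, ← hΨ, ← map_smul]
    exact ⟨_, rfl⟩
  intro a
  obtain ⟨p, hp⟩ := h a.2
  exact ⟨p, Subtype.ext hp⟩

/-- The `q`-Gaussian algebra is freely generated by the variables of an orthonormal basis. -/
noncomputable def freeEquiv [Fintype κ] (q : Set.Ioo (-1 : ℝ) 1) (b : OrthonormalBasis κ ℝ E) :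
    NCPoly κ ≃⋆ₐ[ℂ] gaussianAlgebra E q :=
  StarAlgEquiv.ofBijective (evalGen q b) ⟨evalGen_injective b.orthonormal, evalGen_surjective b⟩

theorem freeEquiv_X [Fintype κ] (b : OrthonormalBasis κ ℝ E) (i : κ) :
    freeEquiv q b (NCPoly.X i) = gen q (b i) :=
  evalGen_X b i

end Gaussian

end QGaussian

theorem mainTheorem9 (E : Type*) [NormedAddCommGroup E] [InnerProductSpace ℝ E]
    [FiniteDimensional ℝ E] (q : Set.Ioo (-1 : ℝ) 1) :
    (∀ b : OrthonormalBasis (Fin (Module.finrank ℝ E)) ℝ E,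
      ∃ Φ : NCPoly (Fin (Module.finrank ℝ E)) ≃⋆ₐ[ℂ] QGaussian.gaussianAlgebra E q,
        ∀ i, Φ (NCPoly.X i) = QGaussian.gen q (b i)) ∧
    (∀ (V : Type*) [AddCommGroup V] [Module ℂ V]
      (M : Hochschild.Bimodule ℂ (QGaussian.gaussianAlgebra E q) V) (n : ℕ),
      2 ≤ n → Subsingleton (M.cohomology n)) := by
  refine ⟨fun b => ⟨QGaussian.freeEquiv q b, QGaussian.freeEquiv_X b⟩, fun V _ _ M n hn => ?_⟩
  obtain ⟨n, rfl⟩ := Nat.exists_eq_add_of_le' hn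
  let e₀ : NCPoly (Fin (Module.finrank ℝ E)) ≃ₐ[ℂ] QGaussian.gaussianAlgebra E q :=
    StarAlgEquiv.toAlgEquiv (QGaussian.freeEquiv q (stdOrthonormalBasis ℝ E))
  -- The involution plays no role in the cohomology, and `NCPoly` is by definition the free algebra.
  let e : FreeAlgebra ℂ (Fin (Module.finrank ℝ E)) ≃ₐ[ℂ] QGaussian.gaussianAlgebra E q := e₀
  exact M.subsingleton_cohomology_succ_iff.2 fun f hf => M.exists_d_eq_of_algEquiv e n f hf
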